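/- Let $F$ be a field of characteristic zero, let $k\ge 2$, and let $L=\operatorname{Der}(M_k(F))$ be the Lie algebra of all $F$-linear derivations of $M_k(F)$. An $L$-algebra is an associative (not necessarily unital) $F$-algebra $B$ with a Lie algebra homomorphism $L\to\operatorname{Der}(B)$; it extends to an algebra homomorphism $U(L)\to\operatorname{End}_F(B)$, and $b^u$ denotes the image of $b\in B$ under the endomorphism given by $u\in U(L)$. The algebra $M_k(F)$ is an $L$-algebra with the tautological action; let $\phi:U(L)\to\operatorname{End}_F(M_k(F))$ be the corresponding homomorphism. Differential polynomials are the elements of the free nonunital $L$-algebra $F\langle X|L\rangle$, $X=\{x_1,x_2,\dots\}$, with basis the monomials $x_{i_1}^{e_1}\cdots x_{i_n}^{e_n}$, $n\ge 1$, $e_j$ in a basis of $U(L)$. A differential identity of $B$ is a differential polynomial vanishing under all evaluations in $B$. A variety is the class of all $L$-algebras satisfying a given set of differential identities, and $\mathcal V$ denotes the variety generated by $M_k(F)$, i.e. the class of all $L$-algebras satisfying all differential identities of $M_k(F)$. For a variety $\mathcal W$ let $c_n^L(\mathcal W)$ be the dimension of the space of multilinear differential polynomials in $x_1,\dots,x_n$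 modulo the identities of $\mathcal W$. The variety $\mathcal W$ has polynomial growth if these dimensions are finite and there are $C,t>0$ with $c^L_n(\mathcal W)\le Cn^t$ for all $n\ge1$. Theorem. The variety $\mathcal V$ has almost polynomial growth. That is: (1) $c_n^L(\mathcal V)$ is finite for all $n\ge 1$, the sequence $c_n^L(\mathcal V)$ is not polynomially bounded, and in fact it grows exponentially: the limit $\lim_{n\to\infty} c_n^L(\mathcal V)^{1/n}$ exists and is greater than $1$. (2) Every variety $\mathcal W\subsetneq\mathcal V$ has polynomial growth. (3) Let $\mathcal S=\{e_{ij} : i\ne j\}\cup\{e_{ii}-e_{i+1,i+1} : 1\le i<k\}$, a basis of $\mathfrak{sl}_k(F)$, and for $a,b\in\mathcal S$ let $\varphi_{ab}\in\operatorname{End}_F(M_k(F))$ be the linear map sending $a$ to $b$ and all other elements of the basis $\mathcal S\cup\{I_k\}$ of $M_k(F)$ to $0$. Then every variety $\mathcal W\subsetneq\mathcal V$ satisfies, for some $t\ge 1$ and all $n\ge t$, all $U$-monomial identities $x_1^{\varphi_{a_1b_1}}\cdots x_n^{\varphi_{a_nb_n}}$ with $a_i,b_i\in\mathcal S$; that is,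 all $\varphi_{a_ib_i}$ lie in $U=\phi(U(L))$, and $x_1^{u_1}\cdots x_n^{u_n}$ is a differential identity of $\mathcal W$ for all $u_i\in U(L)$ with $\phi(u_i)=\varphi_{a_ib_i}$. (For $k=2$ this includes the alternating monomials with $b_i\in\{e_{12},e_{21}\}$.) -/

import Mathlib

universe u v w

attribute [local instance 100] LieRing.ofAssociativeRing

noncomputable section

namespace LDiff

/-! ### Algebras with a Lie algebra acting by derivations -/

/-- The Lie algebra `Der(A)` of all `F`-linear derivations of a (not necessarily unital, not
necessarily commutative) associative `F`-algebra `A`, inside `End_F(A)` with the commutator. -/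
def Der (F : Type u) [Field F] (A : Type w) [NonUnitalRing A] [Module F A]
    [IsScalarTower F A A] [SMulCommClass F A A] : LieSubalgebra F (Module.End F A) where
  carrier := {δ | ∀ a b : A, δ (a * b) = δ a * b + a * δ b}
  add_mem' := by
    intro δ ε hδ hε a b
    simp only [Set.mem_ofPred_eq] at hδ hε
    simp only [LinearMap.add_apply, hδ a b, hε a b, add_mul, mul_add]
    abel
  zero_mem' := by
    intro a b
    simp
  smul_mem' := by
    intro c δ hδ a b
    simp only [Set.mem_ofPred_eq] at hδ
    simp only [LinearMap.smul_apply, hδ a b, smul_add, smul_mul_assoc, mul_smul_comm]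
  lie_mem' := by
    intro δ ε hδ hε a b
    have hδ' : ∀ a b : A, δ (a * b) = δ a * b + a * δ b := hδ
    have hε' : ∀ a b : A, ε (a * b) = ε a * b + a * ε b := hε
    simp only [LieRing.of_associative_ring_bracket, LinearMap.sub_apply, Module.End.mul_apply,
      hδ', hε', map_add, sub_mul, mul_sub]
    abel

/-- An `L`-algebra: an associative, not necessarily unital, `F`-algebra together with a
homomorphism of Lie algebras `L → Der(A)`. -/
structure LAlgebra (F : Type u) [Field F] (L : Type v) [LieRing L] [LieAlgebra F L] where
  carrier : Type w
  [ring : NonUnitalRing carrier]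
  [module : Module F carrier]
  [tower : IsScalarTower F carrier carrier]
  [comm : SMulCommClass F carrier carrier]
  act : L →ₗ⁅F⁆ Der F carrier

attribute [instance] LAlgebra.ring LAlgebra.module LAlgebra.tower LAlgebra.comm

section Polynomials

variable (F : Type u) [Field F] (L : Type v) [LieRing L] [LieAlgebra F L]

/-- The vector space `⨁ᵢ xᵢ^{U(L)}` with one copy of `U(L)` for each of the countably many
variables `x₀, x₁, …`; `Finsupp.single i u` is `xᵢ^u`. -/
abbrev VarSpace : Type _ := ℕ →₀ UniversalEnvelopingAlgebra F L

/-- The unital associative algebra freely generated by the symbols `xᵢ^u` subject to linearity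
in `u ∈ U(L)`. -/
abbrev UnitalLPoly : Type _ := TensorAlgebra F (VarSpace F L)

/-- The free nonunital `L`-algebra `F⟨X|L⟩` of differential polynomials, as the space of elements
without constant term of `UnitalLPoly`: it has as a basis the monomials `x_{i₁}^{e₁} ⋯ x_{iₙ}^{eₙ}`
with `n ≥ 1` and `e₁, …, eₙ` in a basis of `U(L)`. -/
def freeLAlgebra : Submodule F (UnitalLPoly F L) :=
  LinearMap.ker
    (TensorAlgebra.algebraMapInv : TensorAlgebra F (VarSpace F L) →ₐ[F] F).toLinearMap

variable {F L}

/-- The differential monomial `x_{i₁}^{u₁} ⋯ x_{iₙ}^{uₙ}`. -/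
def monomial {n : ℕ} (i : Fin n → ℕ) (e : Fin n → UniversalEnvelopingAlgebra F L) :
    UnitalLPoly F L :=
  (List.ofFn fun j => TensorAlgebra.ι F (Finsupp.single (i j) (e j) : VarSpace F L)).prod

variable (F L) in
/-- The space `P_n^L` of multilinear differential polynomials in the first `n` variables. -/
def multilinearPoly (n : ℕ) : Submodule F (UnitalLPoly F L) :=
  Submodule.span F {f | ∃ (σ : Equiv.Perm (Fin n)) (e : Fin n → UniversalEnvelopingAlgebra F L),
    f = monomial (fun j => (σ j : ℕ)) e}

namespace LAlgebra

variable (B : LAlgebra.{u, v, w} F L)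

/-- The algebra homomorphism `φ : U(L) → End_F(B)` extending the action of `L`;
`b^u` is `B.envAct u b`. -/
def envAct : UniversalEnvelopingAlgebra F L →ₐ[F] Module.End F B.carrier :=
  UniversalEnvelopingAlgebra.lift F ((Der F B.carrier).incl.comp B.act)

/-- The linear map sending `xᵢ^u` to `(γᵢ)^u`. -/
def evalVar (γ : ℕ → B.carrier) : VarSpace F L →ₗ[F] B.carrier :=
  Finsupp.lsum F fun i => (LinearMap.applyₗ (γ i)).comp B.envAct.toLinearMap

/-- The evaluation `xᵢ ↦ γᵢ` of polynomials at elements of `B`. As `B` need not have a unit, it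
takes values in `F ⊕ B`; it maps differential polynomials without constant term into `B`. -/
def eval (γ : ℕ → B.carrier) : UnitalLPoly F L →ₐ[F] Unitization F B.carrier :=
  TensorAlgebra.lift F ((Unitization.inrHom F F B.carrier).comp (B.evalVar γ))

/-- `Id^L(B)`: the differential polynomials vanishing under all evaluations in `B`. -/
def identities : Submodule F (UnitalLPoly F L) :=
  freeLAlgebra F L ⊓ ⨅ γ : ℕ → B.carrier, LinearMap.ker (B.eval γ).toLinearMap

end LAlgebra

/-! ### Varieties, codimensions and growth -/

/-- A variety of `L`-algebras: the class of all `L`-algebras satisfying a given set of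
differential identities. -/
def IsVariety (W : Set (LAlgebra.{u, v, w} F L)) : Prop :=
  ∃ S : Set (UnitalLPoly F L), S ⊆ freeLAlgebra F L ∧
    W = {B | S ⊆ (B.identities : Set (UnitalLPoly F L))}

/-- The variety generated by the `L`-algebra `B`: the class of all `L`-algebras satisfying all
the differential identities of `B`. -/
def generatedVariety (B : LAlgebra.{u, v, w} F L) : Set (LAlgebra.{u, v, w} F L) :=
  {C | B.identities ≤ C.identities}

/-- The differential polynomials that are identities of all algebras of the class `W`. -/
def identitiesOf (W : Set (LAlgebra.{u, v, w} F L)) : Submodule F (UnitalLPoly F L) :=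
  freeLAlgebra F L ⊓ ⨅ B ∈ W, B.identities

/-- The identities of the variety generated by `B` are those of `B`. -/
theorem identitiesOf_generatedVariety (B : LAlgebra.{u, v, w} F L) :
    identitiesOf (generatedVariety B) = B.identities := by
  refine le_antisymm ?_ (le_inf inf_le_left (le_iInf₂ fun C hC => hC))
  exact inf_le_right.trans (iInf₂_le B (show B.identities ≤ B.identities from le_rfl))

/-- The class `generatedVariety B` is a variety, the smallest one containing `B`. -/
theorem isLeast_generatedVariety (B : LAlgebra.{u, v, w} F L) :
    IsLeast {W | IsVariety W ∧ B ∈ W} (generatedVariety B) := by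
  refine ⟨⟨⟨B.identities, fun f hf => hf.1, rfl⟩,
    show B.identities ≤ B.identities from le_rfl⟩, ?_⟩
  rintro W ⟨⟨S, -, rfl⟩, hB⟩ C hC
  exact fun f hf => (show B.identities ≤ C.identities from hC) (hB hf)

/-- `P_n^L(W) = P_n^L / (P_n^L ∩ Id^L(W))`. -/
abbrev MultilinearQuotient (W : Set (LAlgebra.{u, v, w} F L)) (n : ℕ) : Type _ :=
  multilinearPoly F L n ⧸ (identitiesOf W).submoduleOf (multilinearPoly F L n)

/-- The differential codimension `c_n^L(W) = dim P_n^L(W)`. -/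
def codim (W : Set (LAlgebra.{u, v, w} F L)) (n : ℕ) : ℕ :=
  Module.finrank F (MultilinearQuotient W n)

/-- All the spaces `P_n^L(W)` are finite dimensional, so that the codimensions are meaningful. -/
def HasFiniteCodim (W : Set (LAlgebra.{u, v, w} F L)) : Prop :=
  ∀ n : ℕ, 1 ≤ n → Module.Finite F (MultilinearQuotient W n)

/-- Polynomial growth: `c_n^L(W) ≤ C n^t` for all `n ≥ 1`. -/
def HasPolynomialGrowth (W : Set (LAlgebra.{u, v, w} F L)) : Prop :=
  HasFiniteCodim W ∧
    ∃ (C : ℝ) (t : ℕ), 0 < C ∧ 0 < t ∧ ∀ n : ℕ, 1 ≤ n → (codim W n : ℝ) ≤ C * (n : ℝ) ^ t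

/-- Almost polynomial growth: the codimensions are finite and not polynomially bounded, but every
proper subvariety has polynomial growth. -/
def HasAlmostPolynomialGrowth (W : Set (LAlgebra.{u, v, w} F L)) : Prop :=
  HasFiniteCodim W ∧ ¬ HasPolynomialGrowth W ∧
    ∀ W' : Set (LAlgebra.{u, v, w} F L), IsVariety W' → W' ⊂ W → HasPolynomialGrowth W'

/-- The exponent `lim c_n^L(W)^{1/n}` exists and equals `d`. -/
def HasExponent (W : Set (LAlgebra.{u, v, w} F L)) (d : ℝ) : Prop :=
  Filter.Tendsto (fun n : ℕ => (codim W n : ℝ) ^ (1 / (n : ℝ))) Filter.atTop (nhds d)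

/-- For endomorphisms `v₁, …, vₙ` of a fixed `L`-algebra `A`: each `vᵢ` lies in `U = φ(U(L))`, and
the `U`-monomial `x₁^{v₁} ⋯ xₙ^{vₙ}` is an identity of the class `W`, i.e. so is every
differential monomial `x₁^{e₁} ⋯ xₙ^{eₙ}` with `φ(eᵢ) = vᵢ`. -/
def IsUMonomialIdentity (A : LAlgebra.{u, v, w} F L) (W : Set (LAlgebra.{u, v, w} F L)) {n : ℕ}
    (v : Fin n → Module.End F A.carrier) : Prop :=
  (∀ i, v i ∈ A.envAct.range) ∧
    ∀ e : Fin n → UniversalEnvelopingAlgebra F L, (∀ i, A.envAct (e i) = v i) →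
      monomial (fun i : Fin n => (i : ℕ)) e ∈ identitiesOf W

end Polynomials

/-! ### Matrix algebras -/

section Matrices

variable (F : Type u) [Field F] (k : ℕ)

/-- `L = Der(M_k(F))`. -/
abbrev MatDer : Type u := Der F (Matrix (Fin k) (Fin k) F)

/-- `M_k(F)` as an `L`-algebra for `L = Der(M_k(F))`, with the tautological action. -/
def matAlgebra : LAlgebra.{u, u, u} F (MatDer F k) where
  carrier := Matrix (Fin k) (Fin k) F
  act := LieHom.id

/-- Indices of the basis `S` of `sl_k(F)` formed by `hᵢ = eᵢᵢ - eᵢ₊₁,ᵢ₊₁` and by `eᵢⱼ`, `i ≠ j`. -/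
abbrev SIndex : Type := {i : Fin k // (i : ℕ) + 1 < k} ⊕ {p : Fin k × Fin k // p.1 ≠ p.2}

variable {k}

/-- The basis `S` of `sl_k(F)`. Together with the identity matrix it is a basis of `M_k(F)`
when `F` has characteristic zero and `k ≥ 1`. -/
def sMatrix : SIndex k → Matrix (Fin k) (Fin k) F
  | .inl i => Matrix.single i.1 i.1 1 - Matrix.single ⟨i.1 + 1, i.2⟩ ⟨i.1 + 1, i.2⟩ 1
  | .inr p => Matrix.single p.1.1 p.1.2 1

/-- The coefficient functional `x ↦ μ_a^x` of `a ∈ S` in the basis `S ∪ {I_k}` of `M_k(F)`. -/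
def sCoeff : SIndex k → Matrix (Fin k) (Fin k) F →ₗ[F] F
  | .inl i => ∑ j ∈ Finset.univ.filter (fun j : Fin k => j ≤ i.1),
      (Matrix.entryLinearMap F F j j - (k : F)⁻¹ • Matrix.traceLinearMap (Fin k) F F)
  | .inr p => Matrix.entryLinearMap F F p.1.1 p.1.2

/-- `φ_{ab}(x) = μ_a^x b`: the endomorphism of `M_k(F)` sending the basis element `a` to `b` and
all other elements of the basis `S ∪ {I_k}` to `0`. -/
def phi (a b : SIndex k) : Module.End F (matAlgebra F k).carrier :=
  (sCoeff F a).smulRight (sMatrix F b)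

theorem sCoeff_one [CharZero F] (a : SIndex k) : sCoeff F a 1 = 0 := by
  rcases a with i | p
  · have hk : (k : F) ≠ 0 := Nat.cast_ne_zero.mpr (by have := i.2; omega)
    simp [sCoeff, hk]
  · simp [sCoeff, p.2]

theorem sCoeff_sMatrix (a c : SIndex k) : sCoeff F a (sMatrix F c) = if c = a then 1 else 0 := by
  rcases a with i | p <;> rcases c with l | q
  · have h : ∀ m : Fin k, (∑ j ∈ Finset.univ.filter (fun j : Fin k => j ≤ i.1),
        if m = j then (1 : F) else 0) = if m ≤ i.1 then 1 else 0 := by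
      intro m
      rw [Finset.sum_ite_eq]
      simp
    have hl : (⟨l.1 + 1, l.2⟩ : Fin k) ≤ i.1 ↔ (l.1 : ℕ) + 1 ≤ i.1 := Iff.rfl
    have hl' : l.1 ≤ i.1 ↔ (l.1 : ℕ) ≤ i.1 := Iff.rfl
    have he : l = i ↔ (l.1 : ℕ) = i.1 := by rw [Subtype.ext_iff, Fin.ext_iff]
    simp only [sCoeff, sMatrix, LinearMap.sum_apply, LinearMap.sub_apply, LinearMap.smul_apply,
      Matrix.traceLinearMap_apply, Matrix.trace_sub, Matrix.trace_single_eq_same, sub_self,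
      smul_zero, Matrix.entryLinearMap_apply, Matrix.sub_apply, Matrix.single_apply,
      and_self, Finset.sum_sub_distrib, h, Sum.inl.injEq, hl, hl', he]
    split_ifs <;> first | omega | simp
  · have h : ∀ j : Fin k, ¬ (q.1.1 = j ∧ q.1.2 = j) := fun j hj => q.2 (hj.1.trans hj.2.symm)
    simp [sCoeff, sMatrix, h, Matrix.trace_single_eq_of_ne _ _ _ q.2]
  · have h : ∀ j : Fin k, ¬ (j = p.1.1 ∧ j = p.1.2) := fun j hj => p.2 (hj.1.symm.trans hj.2)
    simp [sCoeff, sMatrix, h]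
  · simp [sCoeff, sMatrix, Matrix.single_apply, Subtype.ext_iff, Prod.ext_iff]

end Matrices

end LDiff

end

open LDiff Filter Topology

/-!
Write `A = M_k(F)`, `L = Der(A)`, and let `μ_a`, `a ∈ S ∪ {I_k}`, be the coordinate functionals of
`A` in the basis `S ∪ {I_k}`.

*Density.* The operator `x ↦ e_{ij} x e_{ij}` is a multiple of `(ad e_{ij})²`, and the trace form is
invariant, so irreducibility of `sl_k(F)` puts all the operators `x ↦ μ_a(x) b` with `a, b ∈ S` in
`φ(U(L))` (`smulRight_sCoeff_mem_range`); hence also the projection `x ↦ μ_I(x) I`.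

*Codimensions of the variety of `A`.* A multilinear polynomial is determined modulo the identities
of `A` by its values at the `dⁿ` tuples of basis elements, `d = k²`, so `c_n ≤ dⁿ · d`. Conversely,
since `h = e₁₁ - e₂₂` is not nilpotent, the monomials formed with `x ↦ μ_a(x) h` and
`x ↦ μ_I(x) I` separate these tuples, so `dⁿ ≤ c_n` (`pow_card_le_codim`). Hence the exponent is
`d`.

*Proper subvarieties.* Polynomials modulo the identities of `A` are functions on sequences of
matrices. The functions that come from identities of `W` form an ideal stable under substitutions
(`subst_mem_identityFun`). Let `T` be the space of scalar functions `g` such that `g • C` comes from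
a polynomial without constant term for every constant matrix `C`. It contains the products
`μ_a(x_i) μ_b(x_j)`, `a, b ∈ S`, as the products of two elements of `S` span `A`. If `f` is an
identity of `W` with `f(γ) ≠ 0` for some matrices `γ_i`, substitute `g • γ_i` with `g ∈ T` and
isolate a matrix entry: there is a nonzero polynomial `p` such that all `h h' p(g) • C`, with
`h, h', g ∈ T`, come from identities of `W` (`exists_polynomial_mul_mem`). Going up to degree two
avoids a separate treatment of the `I_k`-components of the `γ_i`. Extracting the leading
coefficient and polarizing, one finds that all products of `deg p + 2` elements of `T` have this
property, and so does every product of coordinate functions with sufficiently many factors `μ_a`,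
`a ∈ S` (`exists_prod_extCoeff_mem`). This gives the monomial identities at once. It also shows that
modulo the identities of `W` a multilinear polynomial is determined by its values at tuples of
basis elements in which only boundedly many entries differ from `I_k`, and there are only
polynomially many of these.
-/

namespace LDiff

/-! ### Evaluation and substitution of differential polynomials -/

section Substitution

variable {F : Type u} [Field F] {L : Type v} [LieRing L] [LieAlgebra F L]

theorem mem_freeLAlgebra {f : UnitalLPoly F L} :
    f ∈ freeLAlgebra F L ↔ TensorAlgebra.algebraMapInv f = 0 := by
  simp [freeLAlgebra]

/-- `U(L)` is generated as an algebra by `L`. -/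
theorem adjoin_range_envelopingι :
    Algebra.adjoin F (Set.range (UniversalEnvelopingAlgebra.ι F : L → _)) = ⊤ := by
  have h : (UniversalEnvelopingAlgebra.mkAlgHom F L).range = ⊤ :=
    (AlgHom.range_eq_top _).2 Quotient.mk_surjective
  rw [← h, ← Algebra.map_top, ← TensorAlgebra.adjoin_range_ι, AlgHom.map_adjoin, ← Set.range_comp]
  rfl

namespace LAlgebra

variable (B : LAlgebra.{u, v, w} F L)

theorem evalVar_single (γ : ℕ → B.carrier) (i : ℕ) (e : UniversalEnvelopingAlgebra F L) :
    B.evalVar γ (Finsupp.single i e) = B.envAct e (γ i) := by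
  simp [evalVar]

theorem eval_ι (γ : ℕ → B.carrier) (x : VarSpace F L) :
    B.eval γ (TensorAlgebra.ι F x) = Unitization.inr (B.evalVar γ x) := by
  simp [eval]

theorem envAct_ι (x : L) (b : B.carrier) :
    B.envAct (UniversalEnvelopingAlgebra.ι F x) b = (B.act x : Module.End F B.carrier) b := by
  rw [envAct, UniversalEnvelopingAlgebra.lift_ι_apply]
  rfl

theorem act_mul (x : L) (a b : B.carrier) :
    (B.act x : Module.End F B.carrier) (a * b) =
      (B.act x : Module.End F B.carrier) a * b + a * (B.act x : Module.End F B.carrier) b :=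
  (B.act x).2 a b

theorem fst_eval (γ : ℕ → B.carrier) (f : UnitalLPoly F L) :
    (B.eval γ f).fst = TensorAlgebra.algebraMapInv f := by
  have h : (Unitization.fstHom F B.carrier).comp (B.eval γ) = TensorAlgebra.algebraMapInv := by
    apply TensorAlgebra.hom_ext
    ext x
    simp [eval_ι, TensorAlgebra.algebraMapInv]
  exact DFunLike.congr_fun h f

theorem eval_eq_inr (γ : ℕ → B.carrier) {f : UnitalLPoly F L} (hf : f ∈ freeLAlgebra F L) :
    B.eval γ f = Unitization.inr (B.eval γ f).snd := by
  ext
  · simp [fst_eval, mem_freeLAlgebra.1 hf]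
  · simp

theorem mem_identities {f : UnitalLPoly F L} :
    f ∈ B.identities ↔ f ∈ freeLAlgebra F L ∧ ∀ γ, B.eval γ f = 0 := by
  simp [identities]

end LAlgebra

/-- The Leibniz rule makes `g(x)ᵈ`, for `d ∈ L`, a differential polynomial in `x`. -/
theorem exists_eval_act (x : L) (g : UnitalLPoly F L) :
    ∃ g' ∈ freeLAlgebra F L, ∀ (B : LAlgebra.{u, v, w} F L) (γ : ℕ → B.carrier),
      B.eval γ g' = Unitization.inr ((B.act x : Module.End F B.carrier) (B.eval γ g).snd) := by
  induction g using TensorAlgebra.induction with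
  | algebraMap r =>
    exact ⟨0, zero_mem _, fun B γ => by simp [Unitization.algebraMap_eq_inl]⟩
  | ι y =>
    induction y using Finsupp.induction_linear with
    | zero => exact ⟨0, zero_mem _, fun B γ => by simp⟩
    | add y z hy hz =>
      obtain ⟨a, ha, ha'⟩ := hy
      obtain ⟨b, hb, hb'⟩ := hz
      exact ⟨a + b, add_mem ha hb, fun B γ => by simp [ha', hb']⟩
    | single i e =>
      refine ⟨TensorAlgebra.ι F (Finsupp.single i (UniversalEnvelopingAlgebra.ι F x * e)), ?_, ?_⟩
      · rw [mem_freeLAlgebra]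
        simp [TensorAlgebra.algebraMapInv]
      · intro B γ
        rw [LAlgebra.eval_ι, LAlgebra.eval_ι, LAlgebra.evalVar_single, LAlgebra.evalVar_single,
          map_mul, Module.End.mul_apply, LAlgebra.envAct_ι, Unitization.snd_inr]
  | mul a b ha hb =>
    obtain ⟨a', ha, ha'⟩ := ha
    obtain ⟨b', hb, hb'⟩ := hb
    refine ⟨a' * b + a * b', ?_, fun B γ => ?_⟩
    · rw [mem_freeLAlgebra] at *
      simp [ha, hb]
    · rw [map_add, map_mul, map_mul, ha', hb', map_mul]
      ext
      · simp
      · simp [LAlgebra.act_mul]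
        abel
  | add a b ha hb =>
    obtain ⟨a', ha, ha'⟩ := ha
    obtain ⟨b', hb, hb'⟩ := hb
    exact ⟨a' + b', add_mem ha hb, fun B γ => by simp [ha', hb']⟩

/-- For `e ∈ U(L)`, the operation `g(x)ᵉ` is a differential polynomial in `x`. -/
theorem exists_eval_envAct (e : UniversalEnvelopingAlgebra F L) :
    ∀ g ∈ freeLAlgebra F L,
    ∃ g' ∈ freeLAlgebra F L, ∀ (B : LAlgebra.{u, v, w} F L) (γ : ℕ → B.carrier),
      (B.eval γ g').snd = B.envAct e (B.eval γ g).snd := by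
  have he : e ∈ Algebra.adjoin F (Set.range (UniversalEnvelopingAlgebra.ι F : L → _)) := by
    rw [adjoin_range_envelopingι]
    trivial
  induction he using Algebra.adjoin_induction with
  | mem e he =>
    obtain ⟨x, rfl⟩ := he
    intro g _
    obtain ⟨g', hg', h⟩ := exists_eval_act.{u, v, w} x g
    exact ⟨g', hg', fun B γ => by rw [h, LAlgebra.envAct_ι, Unitization.snd_inr]⟩
  | algebraMap r =>
    intro g hg
    exact ⟨r • g, Submodule.smul_mem _ _ hg, fun B γ => by simp [Module.algebraMap_end_apply]⟩
  | add a b _ _ ha hb =>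
    intro g hg
    obtain ⟨g₁, h₁, h₁'⟩ := ha g hg
    obtain ⟨g₂, h₂, h₂'⟩ := hb g hg
    exact ⟨g₁ + g₂, add_mem h₁ h₂, fun B γ => by simp [h₁', h₂']⟩
  | mul a b _ _ ha hb =>
    intro g hg
    obtain ⟨g₁, h₁, h₁'⟩ := hb g hg
    obtain ⟨g₂, h₂, h₂'⟩ := ha g₁ h₁
    exact ⟨g₂, h₂, fun B γ => by rw [h₂', h₁', map_mul, Module.End.mul_apply]⟩

/-- Substituting differential polynomials `q i` for the variables of `f` gives a differential
polynomial: its values in all `L`-algebras are those of `f` at the values of the `q i`. -/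
theorem exists_eval_subst (q : ℕ → UnitalLPoly F L) (hq : ∀ i, q i ∈ freeLAlgebra F L)
    (f : UnitalLPoly F L) :
    ∃ f' : UnitalLPoly F L, TensorAlgebra.algebraMapInv f' = TensorAlgebra.algebraMapInv f ∧
      ∀ (B : LAlgebra.{u, v, w} F L) (γ : ℕ → B.carrier),
        B.eval γ f' = B.eval (fun i => (B.eval γ (q i)).snd) f := by
  induction f using TensorAlgebra.induction with
  | algebraMap r => exact ⟨_, rfl, fun B γ => by simp⟩
  | ι y =>
    induction y using Finsupp.induction_linear with
    | zero => exact ⟨0, by simp, fun B γ => by simp⟩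
    | add y z hy hz =>
      obtain ⟨a, ha, ha'⟩ := hy
      obtain ⟨b, hb, hb'⟩ := hz
      exact ⟨a + b, by simp [ha, hb], fun B γ => by simp [ha', hb']⟩
    | single i e =>
      obtain ⟨g, hg, h⟩ := exists_eval_envAct.{u, v, w} e (q i) (hq i)
      refine ⟨g, ?_, fun B γ => ?_⟩
      · rw [mem_freeLAlgebra.1 hg]
        simp [TensorAlgebra.algebraMapInv]
      · rw [LAlgebra.eval_eq_inr _ _ hg, h, LAlgebra.eval_ι, LAlgebra.evalVar_single]
  | mul a b ha hb =>
    obtain ⟨a', ha, ha'⟩ := ha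
    obtain ⟨b', hb, hb'⟩ := hb
    exact ⟨a' * b', by simp [ha, hb], fun B γ => by simp [ha', hb']⟩
  | add a b ha hb =>
    obtain ⟨a', ha, ha'⟩ := ha
    obtain ⟨b', hb, hb'⟩ := hb
    exact ⟨a' + b', by simp [ha, hb], fun B γ => by simp [ha', hb']⟩

theorem mem_identitiesOf {W : Set (LAlgebra.{u, v, w} F L)} {f : UnitalLPoly F L} :
    f ∈ identitiesOf W ↔ f ∈ freeLAlgebra F L ∧ ∀ B ∈ W, ∀ γ, B.eval γ f = 0 := by
  simp only [identitiesOf, Submodule.mem_inf, Submodule.mem_iInf, LAlgebra.mem_identities]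
  exact ⟨fun h => ⟨h.1, fun B hB => (h.2 B hB).2⟩, fun h => ⟨h.1, fun B hB => ⟨h.1, h.2 B hB⟩⟩⟩

theorem mul_mem_identitiesOf_left {W : Set (LAlgebra.{u, v, w} F L)} {f : UnitalLPoly F L}
    (g : UnitalLPoly F L) (hf : f ∈ identitiesOf W) : g * f ∈ identitiesOf W := by
  rw [mem_identitiesOf] at *
  refine ⟨?_, fun B hB γ => by simp [hf.2 B hB]⟩
  rw [mem_freeLAlgebra, map_mul, mem_freeLAlgebra.1 hf.1, mul_zero]

theorem mul_mem_identitiesOf_right {W : Set (LAlgebra.{u, v, w} F L)} {f : UnitalLPoly F L}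
    (g : UnitalLPoly F L) (hf : f ∈ identitiesOf W) : f * g ∈ identitiesOf W := by
  rw [mem_identitiesOf] at *
  refine ⟨?_, fun B hB γ => by simp [hf.2 B hB]⟩
  rw [mem_freeLAlgebra, map_mul, mem_freeLAlgebra.1 hf.1, zero_mul]

/-- A variety contained in `generatedVariety A` and different from it satisfies an identity which
fails in `A`. -/
theorem exists_mem_identitiesOf_of_ssubset {A : LAlgebra.{u, v, w} F L}
    {W : Set (LAlgebra.{u, v, w} F L)} (hW : IsVariety W) (h : W ⊂ generatedVariety A) :
    ∃ f ∈ identitiesOf W, f ∉ A.identities := by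
  obtain ⟨S, hS, rfl⟩ := hW
  obtain ⟨B, hB, hBS⟩ := Set.exists_of_ssubset h
  obtain ⟨f, hf, hfB⟩ := Set.not_subset.1 hBS
  refine ⟨f, ?_, fun hA => hfB (hB hA)⟩
  exact Submodule.mem_inf.2 ⟨hS hf, by simpa [Submodule.mem_iInf] using fun B hB => hB hf⟩

theorem identities_le_identitiesOf {A : LAlgebra.{u, v, w} F L}
    {W : Set (LAlgebra.{u, v, w} F L)} (h : W ⊆ generatedVariety A) :
    A.identities ≤ identitiesOf W :=
  le_inf inf_le_left (le_iInf₂ fun _ hB => h hB)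

end Substitution

/-! ### Evaluation in matrix algebras -/

section MatrixEvaluation

variable (F : Type u) [Field F] (k : ℕ)

/-- The action `U(L) → End_F(M_k(F))`, `L = Der(M_k(F))`; this is `(matAlgebra F k).envAct` with
its codomain written out. -/
noncomputable def matAct : UniversalEnvelopingAlgebra F (MatDer F k) →ₐ[F]
    Module.End F (Matrix (Fin k) (Fin k) F) :=
  UniversalEnvelopingAlgebra.lift F (Der F (Matrix (Fin k) (Fin k) F)).incl

variable {F k}

/-- Evaluation of differential polynomials at a sequence of matrices. As `M_k(F)` has a unit,
the values can be taken in `M_k(F)` rather than in its unitization. -/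
noncomputable def matEval (γ : ℕ → Matrix (Fin k) (Fin k) F) :
    UnitalLPoly F (MatDer F k) →ₐ[F] Matrix (Fin k) (Fin k) F :=
  TensorAlgebra.lift F
    (Finsupp.lsum F fun i => (LinearMap.applyₗ (γ i)).comp (matAct F k).toLinearMap)

theorem matAct_ι (x : MatDer F k) :
    matAct F k (UniversalEnvelopingAlgebra.ι F x) = x := by
  rw [matAct, UniversalEnvelopingAlgebra.lift_ι_apply]
  rfl

theorem matEval_ι_single (γ : ℕ → Matrix (Fin k) (Fin k) F) (i : ℕ)
    (e : UniversalEnvelopingAlgebra F (MatDer F k)) :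
    matEval γ (TensorAlgebra.ι F (Finsupp.single i e)) = matAct F k e (γ i) := by
  simp [matEval]

theorem matEval_monomial (γ : ℕ → Matrix (Fin k) (Fin k) F) {n : ℕ} (i : Fin n → ℕ)
    (e : Fin n → UniversalEnvelopingAlgebra F (MatDer F k)) :
    matEval γ (monomial i e) = (List.ofFn fun j => matAct F k (e j) (γ (i j))).prod := by
  simp [monomial, map_list_prod, List.map_ofFn, Function.comp_def, matEval_ι_single]

/-- `matEval` agrees with the evaluation in the unitization on polynomials without constant term. -/
theorem eval_matAlgebra (γ : ℕ → (matAlgebra F k).carrier) {f : UnitalLPoly F (MatDer F k)}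
    (hf : f ∈ freeLAlgebra F (MatDer F k)) :
    (matAlgebra F k).eval γ f = Unitization.inr (R := F) (A := (matAlgebra F k).carrier)
      (matEval γ f) := by
  let l : Unitization F (matAlgebra F k).carrier →ₐ[F] Matrix (Fin k) (Fin k) F :=
    Unitization.lift (NonUnitalAlgHom.id F (Matrix (Fin k) (Fin k) F))
  have hl : ∀ b : (matAlgebra F k).carrier, l b = b := fun b =>
    (Unitization.lift_symm_apply_apply l b).symm.trans
      (DFunLike.congr_fun (Unitization.lift.symm_apply_apply _) b)
  have h : l.comp ((matAlgebra F k).eval γ) = matEval γ := by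
    apply TensorAlgebra.hom_ext
    refine Finsupp.lhom_ext fun i e => ?_
    exact ((congrArg l ((matAlgebra F k).eval_ι γ _)).trans (hl _)).trans
      (((matAlgebra F k).evalVar_single γ i e).trans (matEval_ι_single γ i e).symm)
  rw [LAlgebra.eval_eq_inr _ _ hf]
  refine congrArg _ (Eq.trans ?_ (DFunLike.congr_fun h f))
  exact (hl _).symm.trans (congrArg l (LAlgebra.eval_eq_inr _ γ hf).symm)

theorem mem_identities_matAlgebra {f : UnitalLPoly F (MatDer F k)} :
    f ∈ (matAlgebra F k).identities ↔
      f ∈ freeLAlgebra F (MatDer F k) ∧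
        ∀ γ : ℕ → Matrix (Fin k) (Fin k) F, matEval γ f = 0 := by
  rw [LAlgebra.mem_identities]
  refine and_congr_right fun hf => forall_congr' fun γ => ?_
  rw [eval_matAlgebra γ hf]
  exact Unitization.inr_injective.eq_iff' (Unitization.inr_zero F)

end MatrixEvaluation

/-! ### The basis `S ∪ {I_k}` of `M_k(F)` -/

section Basis

variable (F : Type u) [Field F] (k : ℕ)

/-- The basis `S ∪ {I_k}` of `M_k(F)` as a family of matrices; `none` stands for `I_k`. -/
def extMatrix : Option (SIndex k) → Matrix (Fin k) (Fin k) F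
  | none => 1
  | some a => sMatrix F a

variable {k} in
/-- The coefficient functionals of the family `extMatrix`. -/
noncomputable def extCoeff : Option (SIndex k) → Matrix (Fin k) (Fin k) F →ₗ[F] F
  | none => (k : F)⁻¹ • Matrix.traceLinearMap (Fin k) F F
  | some a => sCoeff F a

theorem trace_sMatrix {k : ℕ} (a : SIndex k) : (sMatrix F a).trace = 0 := by
  rcases a with i | p
  · simp [sMatrix, Matrix.trace_sub]
  · simp [sMatrix, Matrix.trace_single_eq_of_ne _ _ _ p.2]

theorem extCoeff_extMatrix [CharZero F] {k : ℕ} (hk : 2 ≤ k) (a c : Option (SIndex k)) :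
    extCoeff F a (extMatrix F k c) = if c = a then 1 else 0 := by
  have hk0 : (k : F) ≠ 0 := Nat.cast_ne_zero.mpr (by omega)
  rcases a with _ | a <;> rcases c with _ | c
  · simp [extCoeff, extMatrix, hk0]
  · simp [extCoeff, extMatrix, trace_sMatrix]
  · simp [extCoeff, extMatrix, sCoeff_one]
  · simp [extCoeff, extMatrix, sCoeff_sMatrix]

theorem card_option_sIndex {k : ℕ} (hk : 2 ≤ k) : Fintype.card (Option (SIndex k)) = k * k := by
  obtain ⟨m, rfl⟩ : ∃ m, k = m + 1 := ⟨k - 1, by omega⟩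
  have h1 : Fintype.card {i : Fin (m + 1) // (i : ℕ) + 1 < m + 1} = m := by
    let e : {i : Fin (m + 1) // (i : ℕ) + 1 < m + 1} ≃ Fin m :=
      { toFun := fun i => ⟨i.1, by have := i.2; omega⟩
        invFun := fun j => ⟨j.castSucc, by have := j.2; simp⟩
        left_inv := fun i => by ext; simp
        right_inv := fun j => by ext; simp }
    rw [Fintype.card_congr e, Fintype.card_fin]
  have h2 : Fintype.card {p : Fin (m + 1) × Fin (m + 1) // p.1 ≠ p.2} =
      (m + 1) * (m + 1) - (m + 1) := by
    rw [Fintype.card_subtype]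
    have := Finset.offDiag_card (Finset.univ : Finset (Fin (m + 1)))
    rw [Finset.card_univ, Fintype.card_fin] at this
    rw [← this]
    congr 1
    ext p
    simp
  rw [Fintype.card_option, Fintype.card_sum, h1, h2]
  have : m + 1 ≤ (m + 1) * (m + 1) := Nat.le_mul_self _
  omega

/-- The basis `S ∪ {I_k}` of `M_k(F)`. -/
noncomputable def extBasis [CharZero F] {k : ℕ} (hk : 2 ≤ k) :
    Module.Basis (Option (SIndex k)) F (Matrix (Fin k) (Fin k) F) :=
  haveI : Nonempty (Option (SIndex k)) := ⟨none⟩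
  basisOfLinearIndependentOfCardEqFinrank (b := extMatrix F k)
    (by
      rw [Fintype.linearIndependent_iff]
      intro g hg a
      have := congrArg (extCoeff F a) hg
      simpa [extCoeff_extMatrix F hk, -Fintype.sum_option, -Fintype.sum_sum_type] using this)
    (by rw [card_option_sIndex hk, Module.finrank_matrix]; simp)

theorem extBasis_apply [CharZero F] {k : ℕ} (hk : 2 ≤ k) (a : Option (SIndex k)) :
    extBasis F hk a = extMatrix F k a := by
  simp [extBasis]

theorem sum_extCoeff_smul [CharZero F] {k : ℕ} (hk : 2 ≤ k) (x : Matrix (Fin k) (Fin k) F) :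
    ∑ a, extCoeff F a x • extMatrix F k a = x := by
  have h : ∑ a, (extCoeff F a).smulRight (extMatrix F k a) = LinearMap.id := by
    refine (extBasis F hk).ext fun c => ?_
    simp [extBasis_apply, extCoeff_extMatrix F hk, -Fintype.sum_option, -Fintype.sum_sum_type]
  simpa using DFunLike.congr_fun h x

/-- Every `b ∈ M_k(F)` is a combination of products of two elements of `S`. -/
theorem span_sMatrix_mul_sMatrix [CharZero F] {k : ℕ} (hk : 2 ≤ k) :
    Submodule.span F {x | ∃ a b : SIndex k, x = sMatrix F a * sMatrix F b} = ⊤ := by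
  have key : ∀ i j : Fin k, Matrix.single i j (1 : F) ∈
      Submodule.span F {x | ∃ a b : SIndex k, x = sMatrix F a * sMatrix F b} := by
    have diag : ∀ i j : Fin k, i ≠ j → Matrix.single i i (1 : F) ∈
        Submodule.span F {x | ∃ a b : SIndex k, x = sMatrix F a * sMatrix F b} := fun i j h =>
      Submodule.subset_span ⟨.inr ⟨(i, j), h⟩, .inr ⟨(j, i), h.symm⟩, by simp [sMatrix]⟩
    have up : ∀ (i j : Fin k) (l : Fin k), i ≠ l → l ≠ j → Matrix.single i j (1 : F) ∈
        Submodule.span F {x | ∃ a b : SIndex k, x = sMatrix F a * sMatrix F b} := fun i j l h h' =>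
      Submodule.subset_span ⟨.inr ⟨(i, l), h⟩, .inr ⟨(l, j), h'⟩, by simp [sMatrix]⟩
    -- needed for `k = 2`, where there is no third index `l`
    have hcons : ∀ (i j : Fin k) (hij : (j : ℕ) = i + 1),
        (Matrix.single i j (1 : F) ∈
          Submodule.span F {x | ∃ a b : SIndex k, x = sMatrix F a * sMatrix F b}) ∧
        Matrix.single j i (1 : F) ∈
          Submodule.span F {x | ∃ a b : SIndex k, x = sMatrix F a * sMatrix F b} := by
      intro i j hij
      have hne : i ≠ j := fun h => by rw [h] at hij; omega
      have hlt : (i : ℕ) + 1 < k := hij ▸ j.2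
      obtain rfl : (⟨i + 1, hlt⟩ : Fin k) = j := Fin.ext hij.symm
      constructor
      · exact Submodule.subset_span ⟨.inl ⟨i, hlt⟩, .inr ⟨(i, _), hne⟩, by
          simp [sMatrix, sub_mul, hne.symm]⟩
      · exact Submodule.subset_span ⟨.inr ⟨(_, i), hne.symm⟩, .inl ⟨i, hlt⟩, by
          simp [sMatrix, mul_sub, hne]⟩
    intro i j
    by_cases hij : i = j
    · subst hij
      by_cases h0 : (i : ℕ) = 0
      · exact diag i ⟨1, hk⟩ (by simp [Fin.ext_iff, h0])
      · exact diag i ⟨0, by omega⟩ (by simpa [Fin.ext_iff] using h0)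
    · by_cases h : ∃ l, i ≠ l ∧ l ≠ j
      · obtain ⟨l, h1, h2⟩ := h
        exact up i j l h1 h2
      · push Not at h
        have hij' : (i : ℕ) ≠ j := fun h => hij (Fin.ext h)
        rcases lt_or_gt_of_ne hij' with hlt | hlt
        · refine (hcons i j ?_).1
          by_contra hne
          have := congrArg Fin.val (h ⟨i + 1, by omega⟩ (by simp [Fin.ext_iff]))
          simp at this
          omega
        · refine (hcons j i ?_).2
          by_contra hne
          have := congrArg Fin.val (h ⟨j + 1, by omega⟩ (by simp [Fin.ext_iff]; omega))
          simp at this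
  rw [eq_top_iff]
  rintro x -
  rw [Matrix.matrix_eq_sum_single x]
  refine Submodule.sum_mem _ fun i _ => Submodule.sum_mem _ fun j _ => ?_
  have : Matrix.single i j (x i j) = x i j • Matrix.single i j (1 : F) := by simp
  rw [this]
  exact Submodule.smul_mem _ _ (key i j)

end Basis

/-! ### The image of `U(L)` contains all operators on `sl_k(F)` -/

section Density

variable {F : Type u} [Field F] {k : ℕ}

/-- The inner derivation `x ↦ yx - xy`. -/
def innerDer (y : Matrix (Fin k) (Fin k) F) : MatDer F k :=
  ⟨LinearMap.mulLeft F y - LinearMap.mulRight F y, fun a b => by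
    simp only [LinearMap.sub_apply, LinearMap.mulLeft_apply, LinearMap.mulRight_apply]
    noncomm_ring⟩

theorem innerDer_mem_range (y : Matrix (Fin k) (Fin k) F) :
    LinearMap.mulLeft F y - LinearMap.mulRight F y ∈ (matAct F k).range :=
  ⟨UniversalEnvelopingAlgebra.ι F (innerDer y), matAct_ι _⟩

/-- A nonzero root vector `e_{ij}` generates `sl_k(F)` as a module over itself. -/
theorem sMatrix_mem_of_bracket_mem [CharZero F] (N : Submodule F (Matrix (Fin k) (Fin k) F))
    (hN : ∀ y, ∀ v ∈ N, y * v - v * y ∈ N) {i j : Fin k} (hij : i ≠ j)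
    (h : Matrix.single i j 1 ∈ N) (a : SIndex k) : sMatrix F a ∈ N := by
  have diag : ∀ p q : Fin k, Matrix.single p q 1 ∈ N →
      Matrix.single q q 1 - Matrix.single p p 1 ∈ N := fun p q h => by
    simpa using hN (Matrix.single q p 1) _ h
  have swap : ∀ p q : Fin k, p ≠ q → Matrix.single p q 1 ∈ N → Matrix.single q p 1 ∈ N := by
    intro p q hpq h
    have h2 := N.smul_mem (-(2 : F)⁻¹) (hN (Matrix.single q p 1) _ (diag p q h))
    convert h2 using 1
    ext s t
    simp [mul_sub, sub_mul, hpq]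
    ring
  have row : ∀ p q l : Fin k, p ≠ q → p ≠ l → Matrix.single p q 1 ∈ N →
      Matrix.single p l 1 ∈ N := by
    intro p q l hpq hpl h
    have := N.neg_mem (hN (Matrix.single q l 1) _ h)
    simpa [hpl.symm] using this
  have all : ∀ p q : Fin k, p ≠ q → Matrix.single p q 1 ∈ N := by
    intro p q hpq
    by_cases hp : i = p
    · subst hp
      exact row i j q hij hpq h
    · exact row p i q (Ne.symm hp) hpq (swap i p hp (row i j p hij hp h))
  rcases a with l | p
  · refine diag _ _ (all _ _ fun h => ?_)
    have := congrArg Fin.val h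
    simp at this
  · exact all _ _ p.2

/-- `S` spans the matrices of trace zero. -/
theorem mem_of_trace_eq_zero [CharZero F] (hk : 2 ≤ k)
    (N : Submodule F (Matrix (Fin k) (Fin k) F)) (hN : ∀ a, sMatrix F a ∈ N)
    {x : Matrix (Fin k) (Fin k) F} (hx : x.trace = 0) : x ∈ N := by
  rw [← sum_extCoeff_smul F hk x]
  refine Submodule.sum_mem _ fun a _ => ?_
  rcases a with _ | a
  · simp [extCoeff, hx]
  · exact N.smul_mem _ (hN a)

/-- The functional `x ↦ tr(vx)`. -/
def traceForm : Matrix (Fin k) (Fin k) F →ₗ[F] Matrix (Fin k) (Fin k) F →ₗ[F] F :=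
  (LinearMap.mul F (Matrix (Fin k) (Fin k) F)).compr₂ (Matrix.traceLinearMap (Fin k) F F)

theorem traceForm_apply (v x : Matrix (Fin k) (Fin k) F) : traceForm v x = (v * x).trace := rfl

theorem exists_traceForm_eq_sCoeff [CharZero F] (a : SIndex k) :
    ∃ v : Matrix (Fin k) (Fin k) F, v.trace = 0 ∧ traceForm v = sCoeff F a := by
  -- every functional is a trace form; it vanishes at `1` if and only if `v` has trace zero
  have key : ∀ f : Matrix (Fin k) (Fin k) F →ₗ[F] F, f 1 = 0 →
      ∃ v : Matrix (Fin k) (Fin k) F, v.trace = 0 ∧ traceForm v = f := by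
    intro f hf
    have h : traceForm (Matrix.of fun i j => f (Matrix.single j i 1)) = f := by
      refine Matrix.ext_linearMap F fun i j => LinearMap.ext_ring ?_
      simp [traceForm_apply, Matrix.trace_mul_single]
    refine ⟨_, ?_, h⟩
    have h1 := DFunLike.congr_fun h 1
    rwa [hf, traceForm_apply, mul_one] at h1
  exact key _ (sCoeff_one F a)

/-- Every rank one operator `x ↦ tr(vx)w` with `v, w ∈ sl_k(F)` lies in `φ(U(L))`. The operator
`x ↦ e_{ij} x e_{ij}` is a multiple of `(ad e_{ij})²`, and the set of pairs `(v, w)` is stable under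
`sl_k(F)` acting on either component, as the trace form is invariant. -/
theorem smulRight_traceForm_mem_range [CharZero F] (hk : 2 ≤ k)
    {v w : Matrix (Fin k) (Fin k) F} (hv : v.trace = 0) (hw : w.trace = 0) :
    (traceForm v).smulRight w ∈ (matAct F k).range := by
  set U := (matAct F k).range
  let i : Fin k := ⟨0, by omega⟩
  let j : Fin k := ⟨1, by omega⟩
  have hij : i ≠ j := by simp [i, j]
  have base : (traceForm (Matrix.single i j 1)).smulRight (Matrix.single i j (1 : F)) ∈ U := by
    have h := U.smul_mem (U.mul_mem (innerDer_mem_range (Matrix.single i j (1 : F)))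
      (innerDer_mem_range (Matrix.single i j (1 : F)))) (-(2 : F)⁻¹)
    convert h using 1
    refine LinearMap.ext fun x => ?_
    have hxx : Matrix.single i j (1 : F) * x * Matrix.single i j 1 =
        x j i • Matrix.single i j 1 := by
      simp
    change (Matrix.single i j (1 : F) * x).trace • Matrix.single i j (1 : F) = (-(2 : F)⁻¹) •
      (Matrix.single i j 1 * (Matrix.single i j 1 * x - x * Matrix.single i j 1) -
        (Matrix.single i j 1 * x - x * Matrix.single i j 1) * Matrix.single i j 1)
    rw [mul_sub, sub_mul, ← mul_assoc, ← mul_assoc, mul_assoc x,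
      Matrix.single_mul_single_of_ne _ _ _ _ hij.symm, zero_mul, mul_zero, hxx,
      Matrix.trace_single_mul]
    module
  let N₁ := U.toSubmodule.comap ((LinearMap.smulRightₗ.flip (Matrix.single i j (1 : F))).comp
    (traceForm (F := F) (k := k)))
  have hN₁ : v ∈ N₁ := by
    refine mem_of_trace_eq_zero hk N₁ (sMatrix_mem_of_bracket_mem N₁ ?_ hij base) hv
    intro y v hv
    have h := U.neg_mem (U.mul_mem hv (innerDer_mem_range y))
    change _ ∈ U
    convert h using 1
    refine LinearMap.ext fun x => ?_
    change ((y * v - v * y) * x).trace • Matrix.single i j (1 : F) =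
      -((v * (y * x - x * y)).trace • Matrix.single i j (1 : F))
    rw [← neg_smul, sub_mul, mul_sub, Matrix.trace_sub, Matrix.trace_sub, ← mul_assoc, ← mul_assoc,
      Matrix.trace_mul_comm _ y, ← mul_assoc y, neg_sub]
  let N₂ := U.toSubmodule.comap (LinearMap.smulRightₗ (traceForm v))
  refine mem_of_trace_eq_zero hk N₂ (sMatrix_mem_of_bracket_mem N₂ ?_ hij hN₁) hw
  intro y w hw
  change _ ∈ U
  convert U.mul_mem (innerDer_mem_range y) hw using 1
  refine LinearMap.ext fun x => ?_
  simp [smul_sub]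

theorem smulRight_sCoeff_mem_range [CharZero F] (hk : 2 ≤ k) (a b : SIndex k) :
    (sCoeff F a).smulRight (sMatrix F b) ∈ (matAct F k).range := by
  obtain ⟨v, hv, h⟩ := exists_traceForm_eq_sCoeff (F := F) a
  rw [← h]
  exact smulRight_traceForm_mem_range hk hv (trace_sMatrix F b)

theorem smulRight_extCoeff_none_mem_range [CharZero F] (hk : 2 ≤ k) :
    (extCoeff F none).smulRight (1 : Matrix (Fin k) (Fin k) F) ∈ (matAct F k).range := by
  have h : (extCoeff F none).smulRight (1 : Matrix (Fin k) (Fin k) F) =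
      1 - ∑ a, (sCoeff F a).smulRight (sMatrix F a) := by
    rw [eq_sub_iff_add_eq]
    refine LinearMap.ext fun x => ?_
    have := sum_extCoeff_smul F hk x
    rw [Fintype.sum_option] at this
    simp only [LinearMap.add_apply, LinearMap.sum_apply, LinearMap.smulRight_apply]
    exact this
  rw [h]
  exact sub_mem (one_mem _) (Subalgebra.sum_mem _ fun a _ => smulRight_sCoeff_mem_range hk a a)

end Density

/-! ### Polarization and polynomial functions -/

section Polarization

variable {F : Type u} [Field F]

/-- If a polynomial in one scalar parameter takes all its values in a subspace, then its
coefficients lie in the subspace. -/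
theorem mem_of_forall_sum_pow_smul_mem [Infinite F] {V : Type*} [AddCommGroup V] [Module F V]
    (N : Submodule F V) (v : ℕ → V) (d : ℕ)
    (h : ∀ s : F, ∑ m ∈ Finset.range d, s ^ m • v m ∈ N) {m : ℕ} (hm : m < d) : v m ∈ N := by
  rw [← Submodule.Quotient.mk_eq_zero N, ← Module.forall_dual_apply_eq_zero_iff F]
  intro ℓ
  let p : Polynomial F :=
    ∑ m ∈ Finset.range d, Polynomial.monomial m (ℓ (Submodule.Quotient.mk (v m)))
  have hp : p = 0 := by
    refine Polynomial.funext fun s => ?_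
    have hs := congrArg ℓ ((Submodule.Quotient.mk_eq_zero N).2 (h s))
    rw [← Submodule.mkQ_apply, map_sum, map_sum, map_zero] at hs
    simpa [p, Polynomial.eval_finsetSum, mul_comm] using hs
  have := congrArg (fun q => Polynomial.coeff q m) hp
  simpa [p, Polynomial.finsetSum_coeff, Polynomial.coeff_monomial, hm] using this

/-- Polarization: a subspace containing the multiples `h * g ^ d` of all `d`-th powers of elements
of `T` contains the multiples by `h` of all products of `d` elements of `T`. -/
theorem mul_prod_mem_of_forall_mul_pow_mem [CharZero F] {X : Type*} [CommRing X] [Algebra F X]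
    (N T : Submodule F X) (l : List X) (hl : ∀ g ∈ l, g ∈ T) (h : X)
    (hd : ∀ g ∈ T, h * g ^ l.length ∈ N) : h * l.prod ∈ N := by
  induction l generalizing h with
  | nil => simpa using hd 0 T.zero_mem
  | cons g₁ l ih =>
    rw [List.prod_cons, ← mul_assoc]
    refine ih (fun g hg => hl g (List.mem_cons_of_mem _ hg)) _ fun g hg => ?_
    -- the coefficient of `s` in `h * (s • g₁ + g) ^ (length l + 1)`
    have hmem := mem_of_forall_sum_pow_smul_mem N
      (fun m => h * (g₁ ^ m * g ^ (l.length + 1 - m) * ((l.length + 1).choose m : X)))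
      (l.length + 1 + 1) (fun s => by
        have h1 := hd (s • g₁ + g) (T.add_mem (T.smul_mem s (hl g₁ List.mem_cons_self)) hg)
        rw [List.length_cons, add_pow, Finset.mul_sum] at h1
        convert h1 using 2 with m hm
        rw [smul_pow, smul_mul_assoc, smul_mul_assoc, mul_smul_comm]) (m := 1) (by omega)
    have hne : ((l.length + 1 : ℕ) : F) ≠ 0 := Nat.cast_ne_zero.2 (by omega)
    have h2 := N.smul_mem ((l.length + 1 : ℕ) : F)⁻¹ hmem
    convert h2 using 1
    simp only [pow_one, Nat.choose_one_right, Nat.add_sub_cancel]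
    rw [eq_inv_smul_iff₀ hne, Algebra.smul_def, map_natCast]
    ring

end Polarization

section PolynomialFunctions

variable {F : Type u} [Field F] {k : ℕ}

/-- The function on sequences of matrices defined by a differential polynomial. -/
noncomputable def evalFun : UnitalLPoly F (MatDer F k) →ₐ[F]
    ((ℕ → Matrix (Fin k) (Fin k) F) → Matrix (Fin k) (Fin k) F) :=
  AlgHom.pi fun γ => matEval γ

theorem evalFun_apply (f : UnitalLPoly F (MatDer F k)) (γ : ℕ → Matrix (Fin k) (Fin k) F) :
    evalFun f γ = matEval γ f := rfl

/-- The functions on sequences of matrices defined by the identities of the class `W`. For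
`W = ∅` these are all the functions defined by differential polynomials without constant term. -/
noncomputable def identityFun (W : Set (LAlgebra.{u, u, u} F (MatDer F k))) :
    Submodule F ((ℕ → Matrix (Fin k) (Fin k) F) → Matrix (Fin k) (Fin k) F) :=
  (identitiesOf W).map evalFun.toLinearMap

/-- The scalar functions `g` all whose multiples `g • C`, for constant matrices `C`, are defined
by identities of the class `W`. -/
noncomputable def scalarIdentityFun (W : Set (LAlgebra.{u, u, u} F (MatDer F k))) :
    Submodule F ((ℕ → Matrix (Fin k) (Fin k) F) → F) where
  carrier := {g | ∀ C : Matrix (Fin k) (Fin k) F, (fun γ => g γ • C) ∈ identityFun W}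
  add_mem' := fun {a b} ha hb C => by
    convert add_mem (ha C) (hb C) using 1
    funext γ
    exact add_smul _ _ _
  zero_mem' := fun C => by
    convert zero_mem (identityFun W) using 1
    funext γ
    exact zero_smul _ _
  smul_mem' := fun c a ha C => by
    convert Submodule.smul_mem _ c (ha C) using 1
    funext γ
    exact mul_smul _ _ _

variable {W : Set (LAlgebra.{u, u, u} F (MatDer F k))}

theorem identitiesOf_empty :
    identitiesOf (∅ : Set (LAlgebra.{u, u, u} F (MatDer F k))) = freeLAlgebra F (MatDer F k) := by
  simp [identitiesOf]

theorem mul_mem_identityFun_left {φ ψ} (hφ : φ ∈ identityFun (F := F) (k := k) ∅)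
    (hψ : ψ ∈ identityFun W) : φ * ψ ∈ identityFun W := by
  obtain ⟨f, -, rfl⟩ := hφ
  obtain ⟨g, hg, rfl⟩ := hψ
  exact ⟨f * g, mul_mem_identitiesOf_left f hg, map_mul evalFun f g⟩

theorem mul_mem_identityFun_right {φ ψ} (hφ : φ ∈ identityFun W)
    (hψ : ψ ∈ identityFun (F := F) (k := k) ∅) : φ * ψ ∈ identityFun W := by
  obtain ⟨f, hf, rfl⟩ := hφ
  obtain ⟨g, -, rfl⟩ := hψ
  exact ⟨f * g, mul_mem_identitiesOf_right g hf, map_mul evalFun f g⟩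

/-- The functions defined by identities of `W` are stable under substitutions. -/
theorem subst_mem_identityFun {φ} (hφ : φ ∈ identityFun W)
    {q : ℕ → (ℕ → Matrix (Fin k) (Fin k) F) → Matrix (Fin k) (Fin k) F}
    (hq : ∀ i, q i ∈ identityFun ∅) : (fun γ => φ fun i => q i γ) ∈ identityFun W := by
  obtain ⟨f, hf, rfl⟩ := hφ
  choose p hp hpq using hq
  rw [identitiesOf_empty] at hp
  obtain ⟨f', hf', h⟩ := exists_eval_subst.{u, u, u} p hp f
  have hfree := (mem_identitiesOf.1 hf).1
  have hfree' : f' ∈ freeLAlgebra F (MatDer F k) := by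
    rwa [mem_freeLAlgebra, hf', ← mem_freeLAlgebra]
  refine ⟨f', mem_identitiesOf.2 ⟨hfree', fun B hB γ => ?_⟩, ?_⟩
  · rw [h]
    exact (mem_identitiesOf.1 hf).2 B hB _
  · funext γ
    have h1 := Unitization.inr_injective (((eval_matAlgebra γ hfree').symm.trans
      (h (matAlgebra F k) γ)).trans (eval_matAlgebra _ hfree))
    refine h1.trans (congrArg (fun γ' => matEval γ' f) (funext fun i => ?_))
    have h2 := congrArg (fun z => z.snd) (eval_matAlgebra γ (hp i))
    rw [← hpq]
    exact h2

/-- Whether a differential polynomial is an identity of `W` depends only on the function it defines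
on matrices, as `W` satisfies all identities of `M_k(F)`. -/
theorem mem_identitiesOf_of_evalFun_mem (hW : W ⊆ generatedVariety (matAlgebra F k))
    {f : UnitalLPoly F (MatDer F k)} (hf : f ∈ freeLAlgebra F (MatDer F k))
    (h : evalFun f ∈ identityFun W) : f ∈ identitiesOf W := by
  obtain ⟨g, hg, hgf⟩ := h
  have h1 : f - g ∈ (matAlgebra F k).identities := by
    rw [mem_identities_matAlgebra]
    refine ⟨sub_mem hf (mem_identitiesOf.1 hg).1, fun γ => ?_⟩
    have := congrFun hgf γ
    rw [map_sub, sub_eq_zero]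
    exact this.symm
  have := add_mem (identities_le_identitiesOf hW h1) hg
  rwa [sub_add_cancel] at this

theorem apply_mem_identityFun {u : Module.End F (Matrix (Fin k) (Fin k) F)}
    (hu : u ∈ (matAct F k).range) (i : ℕ) : (fun γ => u (γ i)) ∈ identityFun (F := F) ∅ := by
  obtain ⟨e, rfl⟩ := hu
  refine ⟨TensorAlgebra.ι F (Finsupp.single i e), ?_, ?_⟩
  · rw [identitiesOf_empty]
    change _ ∈ freeLAlgebra F (MatDer F k)
    rw [mem_freeLAlgebra]
    simp [TensorAlgebra.algebraMapInv]
  · funext γ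
    exact matEval_ι_single γ i e

variable [CharZero F]

theorem sCoeff_smul_sMatrix_mem_identityFun (hk : 2 ≤ k) (i : ℕ) (a b : SIndex k) :
    (fun γ => sCoeff F a (γ i) • sMatrix F b) ∈ identityFun (F := F) (k := k) ∅ :=
  apply_mem_identityFun (smulRight_sCoeff_mem_range hk a b) i

/-- A function `g` lies in `scalarIdentityFun W` if its multiples by products of two elements of
`S` are defined by identities of `W`. -/
theorem mem_scalarIdentityFun_of_sMatrix_mul (hk : 2 ≤ k)
    {g : (ℕ → Matrix (Fin k) (Fin k) F) → F}
    (h : ∀ a b : SIndex k, (fun γ => g γ • (sMatrix F a * sMatrix F b)) ∈ identityFun W) :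
    g ∈ scalarIdentityFun W := by
  intro C
  have hC : C ∈ Submodule.span F {x | ∃ a b : SIndex k, x = sMatrix F a * sMatrix F b} := by
    rw [span_sMatrix_mul_sMatrix F hk]
    trivial
  induction hC using Submodule.span_induction with
  | mem x hx =>
    obtain ⟨a, b, rfl⟩ := hx
    exact h a b
  | zero =>
    convert zero_mem (identityFun W) using 1
    funext γ
    exact smul_zero _
  | add x y _ _ hx hy =>
    convert add_mem hx hy using 1
    funext γ
    exact smul_add _ _ _
  | smul c x _ hx =>
    convert Submodule.smul_mem _ c hx using 1
    funext γ
    exact smul_comm _ _ _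

theorem sCoeff_mul_sCoeff_mem (hk : 2 ≤ k) (i j : ℕ) (a b : SIndex k) :
    (fun γ => sCoeff F a (γ i) * sCoeff F b (γ j)) ∈ scalarIdentityFun (F := F) (k := k) ∅ := by
  refine mem_scalarIdentityFun_of_sMatrix_mul hk fun c d => ?_
  have h := mul_mem_identityFun_left (sCoeff_smul_sMatrix_mem_identityFun (F := F) hk i a c)
    (sCoeff_smul_sMatrix_mem_identityFun hk j b d)
  convert h using 1
  funext γ
  exact (smul_mul_smul_comm _ _ _ _).symm

/-- For `I_k` multiply by `x ↦ μ_I(x) I`; for `a ∈ S` split `C` into products of two elements of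
`S`, the first of which is used up by `x ↦ μ_a(x) b`. -/
theorem extCoeff_mul_mem (hk : 2 ≤ k) {g : (ℕ → Matrix (Fin k) (Fin k) F) → F}
    (hg : g ∈ scalarIdentityFun W) (i : ℕ) (a : Option (SIndex k)) :
    (fun γ => extCoeff F a (γ i) * g γ) ∈ scalarIdentityFun W := by
  rcases a with _ | a
  · intro C
    convert mul_mem_identityFun_left
      (apply_mem_identityFun (smulRight_extCoeff_none_mem_range (F := F) hk) i) (hg C) using 1
    funext γ
    refine Eq.trans ?_ (smul_mul_smul_comm _ _ _ _).symm
    rw [one_mul]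
  · refine mem_scalarIdentityFun_of_sMatrix_mul hk fun c d => ?_
    convert mul_mem_identityFun_left (sCoeff_smul_sMatrix_mem_identityFun hk i a c)
      (hg (sMatrix F d)) using 1
    funext γ
    exact (smul_mul_smul_comm _ _ _ _).symm

end PolynomialFunctions

/-! ### Identities of proper subvarieties -/

section ProperSubvarieties

variable {F : Type u} [Field F] {k : ℕ}

/-- Along a line through the origin a differential polynomial is polynomial in the parameter. -/
theorem exists_matEval_smul_eq (γ : ℕ → Matrix (Fin k) (Fin k) F)
    (f : UnitalLPoly F (MatDer F k)) :
    ∃ M : Matrix (Fin k) (Fin k) (Polynomial F), ∀ s : F,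
      matEval (fun i => s • γ i) f = (Polynomial.evalRingHom s).mapMatrix M := by
  induction f using TensorAlgebra.induction with
  | algebraMap r =>
    refine ⟨algebraMap F _ r, fun s => ?_⟩
    ext i j
    by_cases hij : i = j <;> simp [Matrix.algebraMap_matrix_apply, hij]
  | ι y =>
    induction y using Finsupp.induction_linear with
    | zero => exact ⟨0, fun s => by simp⟩
    | add y z hy hz =>
      obtain ⟨a, ha⟩ := hy
      obtain ⟨b, hb⟩ := hz
      exact ⟨a + b, fun s => by rw [map_add, map_add, map_add, ha, hb]⟩
    | single i e =>
      refine ⟨(matAct F k e (γ i)).map fun c => Polynomial.C c * Polynomial.X, fun s => ?_⟩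
      rw [matEval_ι_single, map_smul]
      ext p q
      change s * matAct F k e (γ i) p q =
        Polynomial.eval s (Polynomial.C (matAct F k e (γ i) p q) * Polynomial.X)
      rw [Polynomial.eval_mul, Polynomial.eval_C, Polynomial.eval_X, mul_comm]
  | mul a b ha hb =>
    obtain ⟨a', ha⟩ := ha
    obtain ⟨b', hb⟩ := hb
    exact ⟨a' * b', fun s => by rw [map_mul, map_mul, ha, hb]⟩
  | add a b ha hb =>
    obtain ⟨a', ha⟩ := ha
    obtain ⟨b', hb⟩ := hb
    exact ⟨a' + b', fun s => by rw [map_add, map_add, ha, hb]⟩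

variable {W : Set (LAlgebra.{u, u, u} F (MatDer F k))}

/-- For an identity `f` of `W` with `f(γ) ≠ 0`, substitute `xᵢ ↦ g • γᵢ` and multiply by matrix
units on both sides in order to isolate a nonzero entry of `f(g • γ)`, a polynomial in `g`. -/
theorem exists_polynomial_mul_mem {f : UnitalLPoly F (MatDer F k)} (hf : f ∈ identitiesOf W)
    (hfA : f ∉ (matAlgebra F k).identities) :
    ∃ p : Polynomial F, p ≠ 0 ∧ ∀ h ∈ scalarIdentityFun (F := F) (k := k) ∅,
      ∀ h' ∈ scalarIdentityFun (F := F) (k := k) ∅, ∀ g ∈ scalarIdentityFun (F := F) (k := k) ∅,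
        h * h' * (fun γ => p.eval (g γ)) ∈ scalarIdentityFun W := by
  have hne : ∃ γ : ℕ → Matrix (Fin k) (Fin k) F, matEval γ f ≠ 0 := by
    by_contra! hc
    exact hfA (mem_identities_matAlgebra.2 ⟨(mem_identitiesOf.1 hf).1, hc⟩)
  obtain ⟨γ, hγ⟩ := hne
  obtain ⟨M, hM⟩ := exists_matEval_smul_eq γ f
  have hij : ∃ i j, M i j ≠ 0 := by
    by_contra! hc
    have h0 : M = 0 := by ext1 i j; exact hc i j
    have h1 := hM 1
    simp only [one_smul, h0, map_zero] at h1
    exact hγ h1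
  obtain ⟨i, j, hij⟩ := hij
  refine ⟨M i j, hij, fun h hh h' hh' g hg C => ?_⟩
  have hsub := subst_mem_identityFun (φ := evalFun f) ⟨f, hf, rfl⟩
    (q := fun i => fun γ' => g γ' • γ i)
    fun i => hg (γ i)
  -- the sum over `p` of `(h • C e_{pi}) f(g • γ) (h' • e_{jp})` is `h h' f(g • γ)_{ij} • C`
  have hsum := Submodule.sum_mem (identityFun W) fun p (_ : p ∈ Finset.univ) =>
    mul_mem_identityFun_right (mul_mem_identityFun_left (hh (C * Matrix.single p i 1)) hsub)
      (hh' (Matrix.single j p 1))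
  convert hsum using 1
  funext γ'
  have hs : ∀ (p : Fin k) (c : F), Matrix.single p p (1 * c * 1) = c • Matrix.single p p (1 : F) :=
    fun p c => by simp
  have hterm : ∀ p : Fin k,
      h γ' • (C * Matrix.single p i 1) * matEval (fun i => g γ' • γ i) f *
        h' γ' • Matrix.single j p (1 : F) =
      (h γ' * h' γ' * (M i j).eval (g γ')) • (C * Matrix.single p p 1) := by
    intro p
    rw [hM, smul_mul_assoc, smul_mul_assoc, mul_smul_comm, mul_assoc C, mul_assoc C,
      Matrix.single_mul_mul_single, smul_smul, hs, mul_smul_comm, smul_smul]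
    rfl
  rw [Finset.sum_apply]
  refine Eq.trans ?_ (Finset.sum_congr rfl fun p _ => (hterm p).symm)
  rw [← Finset.smul_sum, ← Finset.mul_sum]
  have h1 : ∑ p : Fin k, Matrix.single p p (1 : F) = 1 := by
    ext p q
    simp [Matrix.sum_apply, Matrix.single_apply, Matrix.one_apply, ite_and]
  rw [h1, mul_one]
  rfl

variable [CharZero F]

/-- If `W` satisfies an identity that fails in `M_k(F)`, then, for some `r`, the products
`g₁ ⋯ g_r • C`, with `gᵢ` in `scalarIdentityFun ∅` and a constant matrix `C`, are defined by
identities of `W`. -/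
theorem exists_prod_mem_scalarIdentityFun {f : UnitalLPoly F (MatDer F k)}
    (hf : f ∈ identitiesOf W) (hfA : f ∉ (matAlgebra F k).identities) :
    ∃ r : ℕ, 1 ≤ r ∧ ∀ l : List ((ℕ → Matrix (Fin k) (Fin k) F) → F), l.length = r →
      (∀ g ∈ l, g ∈ scalarIdentityFun ∅) → l.prod ∈ scalarIdentityFun W := by
  obtain ⟨p, hp, h⟩ := exists_polynomial_mul_mem hf hfA
  refine ⟨p.natDegree + 2, by omega, fun l hl hlT => ?_⟩
  -- two factors carry the matrix units around the entry, the others come from `g ^ deg p`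
  obtain ⟨h₁, h₂, l, rfl⟩ : ∃ h₁ h₂ l', l = h₁ :: h₂ :: l' := by
    match l, hl with
    | a :: b :: l, _ => exact ⟨a, b, l, rfl⟩
  simp only [List.length_cons, List.forall_mem_cons] at hl hlT
  obtain ⟨hh₁, hh₂, hlT⟩ := hlT
  replace hl : l.length = p.natDegree := by omega
  rw [List.prod_cons, List.prod_cons, ← mul_assoc]
  refine mul_prod_mem_of_forall_mul_pow_mem _ (scalarIdentityFun ∅) l hlT _ fun g hg => ?_
  -- the coefficient of `s ^ deg p` in `h₁ * h₂ * p (s • g)`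
  have hmem := mem_of_forall_sum_pow_smul_mem (scalarIdentityFun W)
    (fun m => p.coeff m • (h₁ * h₂ * g ^ m)) (p.natDegree + 1) (fun s => by
      convert h h₁ hh₁ h₂ hh₂ (s • g) (Submodule.smul_mem _ s hg) using 1
      funext γ
      simp only [Finset.sum_apply, Pi.smul_apply, Pi.mul_apply, Pi.pow_apply, smul_eq_mul,
        Polynomial.eval_eq_sum_range, Finset.mul_sum]
      exact Finset.sum_congr rfl fun m _ => by ring) (Nat.lt_succ_self _)
  have h2 := Submodule.smul_mem _ (p.coeff p.natDegree)⁻¹ hmem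
  rwa [inv_smul_smul₀ (by simpa using hp), ← hl] at h2

/-- Grouping `2r` coordinate functions in pairs gives `r` elements of `scalarIdentityFun ∅`. -/
theorem exists_list_prod_eq_prod_sCoeff (hk : 2 ≤ k) {ι : Type*} (r : ℕ) (s : Finset ι)
    (hs : s.card = 2 * r) (i : ι → ℕ) (a : ι → SIndex k) :
    ∃ l : List ((ℕ → Matrix (Fin k) (Fin k) F) → F), l.length = r ∧
      (∀ g ∈ l, g ∈ scalarIdentityFun ∅) ∧ l.prod = fun γ => ∏ j ∈ s, sCoeff F (a j) (γ (i j)) := by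
  classical
  induction r generalizing s with
  | zero =>
    obtain rfl : s = ∅ := by simpa using hs
    exact ⟨[], rfl, by simp, by funext γ; simp⟩
  | succ r ih =>
    obtain ⟨x, hx⟩ : s.Nonempty := Finset.card_pos.1 (by omega)
    have h1 := Finset.card_erase_of_mem hx
    obtain ⟨y, hy⟩ : (s.erase x).Nonempty := Finset.card_pos.1 (by omega)
    have h2 := Finset.card_erase_of_mem hy
    obtain ⟨l, hl, hlT, hlp⟩ := ih ((s.erase x).erase y) (by omega)
    refine ⟨_ :: l, by rw [List.length_cons, hl],
      List.forall_mem_cons.2 ⟨sCoeff_mul_sCoeff_mem hk (i x) (i y) (a x) (a y), hlT⟩, ?_⟩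
    rw [List.prod_cons, hlp]
    funext γ
    rw [← Finset.mul_prod_erase s _ hx, ← Finset.mul_prod_erase _ _ hy, Pi.mul_apply, mul_assoc]

/-- For a proper subvariety `W`, all products of coordinate functions containing sufficiently many
coordinates with respect to elements of `S` yield identities of `W`. -/
theorem exists_prod_extCoeff_mem (hk : 2 ≤ k) {f : UnitalLPoly F (MatDer F k)}
    (hf : f ∈ identitiesOf W) (hfA : f ∉ (matAlgebra F k).identities) :
    ∃ t : ℕ, 1 ≤ t ∧ ∀ (n : ℕ) (a : Fin n → Option (SIndex k)),
      t ≤ (Finset.univ.filter fun j => a j ≠ none).card →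
        (fun γ => ∏ j, extCoeff F (a j) (γ j)) ∈ scalarIdentityFun W := by
  classical
  obtain ⟨r, hr, h⟩ := exists_prod_mem_scalarIdentityFun hf hfA
  refine ⟨2 * r, by omega, fun n a ha => ?_⟩
  obtain ⟨s, hs, hsr⟩ := Finset.exists_subset_card_eq ha
  have hsne : ∀ j ∈ s, a j ≠ none := fun j hj => (Finset.mem_filter.1 (hs hj)).2
  have base : (fun γ => ∏ j ∈ s, extCoeff F (a j) (γ j)) ∈ scalarIdentityFun W := by
    obtain ⟨c₀⟩ : Nonempty (SIndex k) := ⟨.inl ⟨⟨0, by omega⟩, by simp; omega⟩⟩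
    obtain ⟨l, hl, hlT, hlp⟩ := exists_list_prod_eq_prod_sCoeff (F := F) hk r s hsr
      (fun j => (j : ℕ)) (fun j => (a j).getD c₀)
    convert h l hl hlT using 1
    rw [hlp]
    funext γ
    refine Finset.prod_congr rfl fun j hj => ?_
    obtain ⟨c, hc⟩ := Option.ne_none_iff_exists'.1 (hsne j hj)
    simp [hc, extCoeff]
  have step : ∀ u : Finset (Fin n), Disjoint u s →
      (fun γ => ∏ j ∈ u ∪ s, extCoeff F (a j) (γ j)) ∈ scalarIdentityFun W := by
    intro u
    induction u using Finset.induction_on with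
    | empty =>
      intro _
      simpa using base
    | insert x u hx ih =>
      intro hd
      rw [Finset.disjoint_insert_left] at hd
      have := extCoeff_mul_mem hk (ih hd.2) x (a x)
      convert this using 1
      funext γ
      rw [Finset.insert_union, Finset.prod_insert (by simp [hx, hd.1])]
  have := step sᶜ disjoint_compl_left
  rwa [Finset.union_comm, Finset.union_compl] at this

end ProperSubvarieties

/-! ### Multilinear polynomials and codimensions -/

section Multilinear

variable {F : Type u} [Field F] {k : ℕ}

theorem multilinearPoly_le_freeLAlgebra {n : ℕ} (hn : 1 ≤ n) :
    multilinearPoly F (MatDer F k) n ≤ freeLAlgebra F (MatDer F k) := by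
  refine Submodule.span_le.2 ?_
  rintro _ ⟨σ, e, rfl⟩
  change _ ∈ freeLAlgebra F (MatDer F k)
  obtain ⟨m, rfl⟩ : ∃ m, n = m + 1 := ⟨n - 1, by omega⟩
  rw [mem_freeLAlgebra, monomial, List.ofFn_succ, List.prod_cons, map_mul]
  simp [TensorAlgebra.algebraMapInv]

theorem monomial_mem_multilinearPoly {n : ℕ}
    (e : Fin n → UniversalEnvelopingAlgebra F (MatDer F k)) :
    monomial (fun i : Fin n => (i : ℕ)) e ∈ multilinearPoly F (MatDer F k) n :=
  Submodule.subset_span ⟨1, e, rfl⟩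

/-- The function defined by a multilinear differential polynomial is multilinear. -/
theorem exists_multilinearMap_matEval {n : ℕ} {f : UnitalLPoly F (MatDer F k)}
    (hf : f ∈ multilinearPoly F (MatDer F k) n) :
    ∃ m : MultilinearMap F (fun _ : Fin n => Matrix (Fin k) (Fin k) F) (Matrix (Fin k) (Fin k) F),
      ∀ γ, matEval γ f = m fun i => γ i := by
  induction hf using Submodule.span_induction with
  | mem f hf =>
    obtain ⟨σ, e, rfl⟩ := hf
    refine ⟨((MultilinearMap.mkPiAlgebraFin F n (Matrix (Fin k) (Fin k) F)).compLinearMap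
      fun j => matAct F k (e j)).domDomCongr σ, fun γ => ?_⟩
    rw [matEval_monomial]
    rfl
  | zero => exact ⟨0, fun γ => by simp⟩
  | add a b _ _ ha hb =>
    obtain ⟨a', ha⟩ := ha
    obtain ⟨b', hb⟩ := hb
    exact ⟨a' + b', fun γ => by rw [map_add, ha, hb]; rfl⟩
  | smul c a _ ha =>
    obtain ⟨a', ha⟩ := ha
    exact ⟨c • a', fun γ => by rw [map_smul, ha]; rfl⟩

variable (F k) in
/-- The sequence of matrices starting with the `n` elements `β 0, …, β (n - 1)` of the basis
`S ∪ {I_k}`, continued by zeros. -/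
def extTuple {n : ℕ} (β : Fin n → Option (SIndex k)) (i : ℕ) : Matrix (Fin k) (Fin k) F :=
  if h : i < n then extMatrix F k (β ⟨i, h⟩) else 0

theorem extTuple_apply {n : ℕ} (β : Fin n → Option (SIndex k)) (i : Fin n) :
    extTuple F k β i = extMatrix F k (β i) := by
  simp [extTuple]

/-- The values of multilinear differential polynomials at the tuples of basis elements that
satisfy `P`. -/
noncomputable def extValues (F : Type u) [Field F] (k n : ℕ)
    (P : (Fin n → Option (SIndex k)) → Prop) :
    multilinearPoly F (MatDer F k) n →ₗ[F]
      ({β : Fin n → Option (SIndex k) // P β} → Matrix (Fin k) (Fin k) F) :=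
  (LinearMap.pi fun β => (matEval (extTuple F k β.1)).toLinearMap).domRestrict _

theorem list_prod_ofFn_smul {n : ℕ} (r : Fin n → F) (x : Fin n → Matrix (Fin k) (Fin k) F) :
    (List.ofFn fun j => r j • x j).prod = (∏ j, r j) • (List.ofFn x).prod :=
  (MultilinearMap.mkPiAlgebraFin F n (Matrix (Fin k) (Fin k) F)).map_smul_univ r x

theorem card_le_finrank_quotient_submoduleOf {V ι : Type*} [AddCommGroup V] [Module F V]
    [Fintype ι] (P J : Submodule F V) (w : ι → P) (hfin : Module.Finite F (P ⧸ J.submoduleOf P))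
    (h : ∀ g : ι → F, ∑ c, g c • (w c : V) ∈ J → ∀ c, g c = 0) :
    Fintype.card ι ≤ Module.finrank F (P ⧸ J.submoduleOf P) := by
  have hli : LinearIndependent F fun c => (J.submoduleOf P).mkQ (w c) := by
    rw [Fintype.linearIndependent_iff]
    intro g hg
    simp only [← map_smul] at hg
    rw [← map_sum, Submodule.mkQ_apply, Submodule.Quotient.mk_eq_zero, Submodule.submoduleOf,
      Submodule.mem_comap] at hg
    exact h g (by simpa using hg)
  exact hli.fintype_card_le_finrank

theorem list_prod_mul_eq {M : Type*} [Monoid M] (l : List M) (e : M) (h : ∀ x ∈ l, x * e = e) :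
    l.prod * e = e := by
  induction l with
  | nil => simp
  | cons x l ih =>
    rw [List.prod_cons, mul_assoc, ih fun y hy => h y (List.mem_cons_of_mem _ hy),
      h x List.mem_cons_self]

variable [CharZero F]

/-- Expansion of a multilinear polynomial in the coordinates of its arguments. -/
theorem matEval_eq_sum (hk : 2 ≤ k) {n : ℕ} {f : UnitalLPoly F (MatDer F k)}
    (hf : f ∈ multilinearPoly F (MatDer F k) n) (γ : ℕ → Matrix (Fin k) (Fin k) F) :
    matEval γ f = ∑ β : Fin n → Option (SIndex k),
      (∏ j, extCoeff F (β j) (γ j)) • matEval (extTuple F k β) f := by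
  classical
  obtain ⟨m, hm⟩ := exists_multilinearMap_matEval hf
  have h : (fun j : Fin n => γ j) =
      fun j : Fin n => ∑ a, extCoeff F a (γ j) • extMatrix F k a := by
    funext j
    exact (sum_extCoeff_smul F hk _).symm
  rw [hm, h, MultilinearMap.map_sum]
  refine Finset.sum_congr rfl fun β _ => ?_
  rw [MultilinearMap.map_smul_univ m (fun j => extCoeff F (β j) (γ j))
    (fun j => extMatrix F k (β j)), hm]
  simp only [extTuple_apply]

variable {W : Set (LAlgebra.{u, u, u} F (MatDer F k))}

/-- A multilinear differential polynomial is an identity of `W` if it vanishes at those tuples of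
basis elements for which the product of coordinate functions does not give identities of `W`. -/
theorem mem_identitiesOf_of_forall_matEval_extTuple (hk : 2 ≤ k)
    (hW : W ⊆ generatedVariety (matAlgebra F k)) {n : ℕ} (hn : 1 ≤ n)
    {f : UnitalLPoly F (MatDer F k)} (hf : f ∈ multilinearPoly F (MatDer F k) n)
    (h : ∀ β : Fin n → Option (SIndex k), matEval (extTuple F k β) f = 0 ∨
      (fun γ => ∏ j, extCoeff F (β j) (γ j)) ∈ scalarIdentityFun W) :
    f ∈ identitiesOf W := by
  refine mem_identitiesOf_of_evalFun_mem hW (multilinearPoly_le_freeLAlgebra hn hf) ?_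
  have hsum := Submodule.sum_mem (identityFun W) (t := Finset.univ)
    (f := fun β : Fin n → Option (SIndex k) => fun γ =>
      (∏ j, extCoeff F (β j) (γ j)) • matEval (extTuple F k β) f) fun β _ => by
    rcases h β with h0 | h1
    · rw [h0]
      convert zero_mem (identityFun W) using 1
      funext γ
      exact smul_zero _
    · exact h1 _
  convert hsum using 1
  funext γ
  rw [Finset.sum_apply, evalFun_apply, matEval_eq_sum hk hf γ]

/-- The codimension of `W` is at most `d` times the number of tuples of basis elements whose product
of coordinate functions does not give identities of `W`. -/
theorem finite_and_codim_le (hk : 2 ≤ k) (hW : W ⊆ generatedVariety (matAlgebra F k))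
    {n : ℕ} (hn : 1 ≤ n) (P : (Fin n → Option (SIndex k)) → Prop)
    (h : ∀ β, ¬ P β → (fun γ => ∏ j, extCoeff F (β j) (γ j)) ∈ scalarIdentityFun W) :
    Module.Finite F (MultilinearQuotient W n) ∧
      codim W n ≤ Nat.card {β // P β} * Fintype.card (Option (SIndex k)) := by
  classical
  have hker : LinearMap.ker (extValues F k n P) ≤
      (identitiesOf W).submoduleOf (multilinearPoly F (MatDer F k) n) := by
    intro f hf
    refine mem_identitiesOf_of_forall_matEval_extTuple hk hW hn f.2 fun β => ?_
    by_cases hβ : P β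
    · exact Or.inl (congrFun hf ⟨β, hβ⟩)
    · exact Or.inr (h β hβ)
  have e := (extValues F k n P).quotKerEquivRange
  have : Module.Finite F (multilinearPoly F (MatDer F k) n ⧸ LinearMap.ker (extValues F k n P)) :=
    Module.Finite.equiv e.symm
  have hs := Submodule.factor_surjective hker
  refine ⟨Module.Finite.of_surjective _ hs, ?_⟩
  calc codim W n ≤ Module.finrank F
        (multilinearPoly F (MatDer F k) n ⧸ LinearMap.ker (extValues F k n P)) :=
        LinearMap.finrank_le_finrank_of_surjective hs
    _ = Module.finrank F (LinearMap.range (extValues F k n P)) := e.finrank_eq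
    _ ≤ Module.finrank F ({β // P β} → Matrix (Fin k) (Fin k) F) := Submodule.finrank_le _
    _ = _ := by
      rw [Module.finrank_pi_fintype, Finset.sum_const, Finset.card_univ, Nat.card_eq_fintype_card,
        Module.finrank_eq_card_basis (extBasis F hk), smul_eq_mul]

/-- For each `a ∈ S ∪ {I_k}` there is an operator in `φ(U(L))` of the form `x ↦ μ_a(x) h` with
`h` equal to `I_k` or `e₁₁ - e₂₂`, hence `h e₁₁ = e₁₁`. -/
theorem exists_matAct_eq (hk : 2 ≤ k) (a : Option (SIndex k)) :
    ∃ (e : UniversalEnvelopingAlgebra F (MatDer F k)) (x : Matrix (Fin k) (Fin k) F),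
      x * Matrix.single ⟨0, by omega⟩ ⟨0, by omega⟩ 1 =
        Matrix.single ⟨0, by omega⟩ ⟨0, by omega⟩ 1 ∧
      matAct F k e = (extCoeff F a).smulRight x := by
  rcases a with _ | a
  · obtain ⟨e, he⟩ := smulRight_extCoeff_none_mem_range (F := F) hk
    exact ⟨e, 1, one_mul _, he⟩
  · obtain ⟨e, he⟩ := smulRight_sCoeff_mem_range (F := F) hk a
      (.inl ⟨⟨0, by omega⟩, by simp; omega⟩)
    refine ⟨e, _, ?_, he⟩
    simp [sMatrix, sub_mul]

theorem pow_card_le_codim (hk : 2 ≤ k) {n : ℕ} (hn : 1 ≤ n) :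
    Fintype.card (Option (SIndex k)) ^ n ≤ codim (generatedVariety (matAlgebra F k)) n := by
  classical
  have hfin := (finite_and_codim_le (F := F) hk le_rfl hn (fun _ => True) (by simp)).1
  choose e x hx he using exists_matAct_eq (F := F) hk
  let w : (Fin n → Option (SIndex k)) → multilinearPoly F (MatDer F k) n := fun c =>
    ⟨_, monomial_mem_multilinearPoly fun j => e (c j)⟩
  have hv : ∀ c β : Fin n → Option (SIndex k),
      matEval (extTuple F k β) (monomial (fun i : Fin n => (i : ℕ)) fun j => e (c j)) *
        Matrix.single ⟨0, by omega⟩ ⟨0, by omega⟩ 1 =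
      if c = β then Matrix.single ⟨0, by omega⟩ ⟨0, by omega⟩ (1 : F) else 0 := by
    intro c β
    simp only [matEval_monomial, he, LinearMap.smulRight_apply, extTuple_apply,
      extCoeff_extMatrix F hk]
    rw [list_prod_ofFn_smul, smul_mul_assoc, list_prod_mul_eq]
    · by_cases hc : c = β
      · simp [hc]
      · obtain ⟨j, hj⟩ := Function.ne_iff.1 hc
        rw [Finset.prod_eq_zero (Finset.mem_univ j) (if_neg hj.symm), zero_smul, if_neg hc]
    · intro y hy
      obtain ⟨j, rfl⟩ := (List.mem_ofFn' _ _).1 hy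
      exact hx _
  have hcard := card_le_finrank_quotient_submoduleOf _ _ w hfin fun g hg β => by
    rw [identitiesOf_generatedVariety] at hg
    have h2 := congrArg (· * Matrix.single ⟨0, by omega⟩ ⟨0, by omega⟩ (1 : F))
      ((mem_identities_matAlgebra.1 hg).2 (extTuple F k β))
    simp only [map_sum, map_smul, Finset.sum_mul, smul_mul_assoc, w, hv, smul_ite, smul_zero,
      Finset.sum_ite_eq', Finset.mem_univ, if_true, zero_mul] at h2
    simpa using congrFun (congrFun h2 ⟨0, by omega⟩) ⟨0, by omega⟩
  rw [Fintype.card_fun, Fintype.card_fin] at hcard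
  exact hcard

/-- A tuple with fewer than `t` entries different from `none` is determined by `t` of its entries
together with their positions. -/
theorem card_support_lt_le {ι : Type*} [Finite ι] {n : ℕ} (hn : 1 ≤ n) (t : ℕ) :
    Nat.card {β : Fin n → Option ι // (Finset.univ.filter fun j => β j ≠ none).card < t} ≤
      (n * Nat.card (Option ι)) ^ t := by
  classical
  -- `Φ w` has the entry `(w i).2` at the position `(w i).1`, and `none` at the unlisted positions
  let Φ : (Fin t → Fin n × Option ι) → Fin n → Option ι := fun w j =>
    if h : ∃ i, (w i).1 = j then (w h.choose).2 else none
  have hΦ : ∀ β : {β : Fin n → Option ι // (Finset.univ.filter fun j => β j ≠ none).card < t},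
      ∃ w, Φ w = β.1 := by
    rintro ⟨β, hβ⟩
    set s := Finset.univ.filter fun j => β j ≠ none
    obtain ⟨e⟩ : Nonempty (s ↪ Fin t) :=
      Function.Embedding.nonempty_of_card_le (by simpa using hβ.le)
    let q : Fin t → Fin n := fun i => if h : ∃ j, e j = i then h.choose.1 else ⟨0, hn⟩
    refine ⟨fun i => (q i, β (q i)), funext fun j => ?_⟩
    by_cases h : ∃ i, q i = j
    · simp only [Φ, dif_pos h, h.choose_spec]
    · simp only [Φ, dif_neg h]
      by_contra hj
      refine h ⟨e ⟨j, by simpa [s] using Ne.symm hj⟩, ?_⟩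
      have hex : ∃ j', e j' = e ⟨j, by simpa [s] using Ne.symm hj⟩ := ⟨_, rfl⟩
      simp only [q, dif_pos hex]
      exact congrArg Subtype.val (e.injective hex.choose_spec)
  choose w hw using hΦ
  have hinj : Function.Injective w := fun a b hab => Subtype.ext (by rw [← hw, ← hw, hab])
  refine (Nat.card_le_card_of_injective w hinj).trans_eq ?_
  rw [Nat.card_fun, Nat.card_prod, Nat.card_fin, Nat.card_fin]

end Multilinear

/-! ### Growth -/

section Growth

theorem tendsto_rpow_one_div_of_pow_le {c : ℕ → ℕ} {d : ℕ} (hd : 1 ≤ d)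
    (hc : ∀ n, 1 ≤ n → d ^ n ≤ c n) (hc' : ∀ n, 1 ≤ n → c n ≤ d ^ n * d) :
    Tendsto (fun n : ℕ => (c n : ℝ) ^ (1 / (n : ℝ))) atTop (𝓝 d) := by
  have hd0 : (0 : ℝ) < d := by exact_mod_cast hd
  -- the `n`-th root of the upper bound
  have h1 : Tendsto (fun n : ℕ => (d : ℝ) * (d : ℝ) ^ (1 / (n : ℝ))) atTop (𝓝 d) := by
    have h2 : Tendsto (fun n : ℕ => (d : ℝ) ^ (1 / (n : ℝ))) atTop (𝓝 ((d : ℝ) ^ (0 : ℝ))) :=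
      (Real.continuousAt_const_rpow hd0.ne').tendsto.comp tendsto_one_div_atTop_nhds_zero_nat
    simpa using h2.const_mul (d : ℝ)
  have hroot : ∀ n : ℕ, 1 ≤ n → ((d : ℝ) ^ n) ^ (1 / (n : ℝ)) = d := fun n hn => by
    rw [one_div]
    exact Real.pow_rpow_inv_natCast hd0.le (by omega)
  refine tendsto_of_tendsto_of_tendsto_of_le_of_le' tendsto_const_nhds h1 ?_ ?_
  · filter_upwards [eventually_ge_atTop 1] with n hn
    rw [← hroot n hn]
    exact Real.rpow_le_rpow (by positivity) (by exact_mod_cast hc n hn) (by positivity)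
  · filter_upwards [eventually_ge_atTop 1] with n hn
    calc (c n : ℝ) ^ (1 / (n : ℝ)) ≤ ((d : ℝ) ^ n * d) ^ (1 / (n : ℝ)) :=
          Real.rpow_le_rpow (by positivity) (by exact_mod_cast hc' n hn) (by positivity)
      _ = d * (d : ℝ) ^ (1 / (n : ℝ)) := by
          rw [Real.mul_rpow (by positivity) hd0.le, hroot n hn]

/-- Exponentials with base at least `2` are not polynomially bounded. -/
theorem not_forall_pow_le_mul_pow {d : ℕ} (hd : 2 ≤ d) (C : ℝ) (hC : 0 < C) (t : ℕ) :
    ¬ ∀ n : ℕ, 1 ≤ n → (d : ℝ) ^ n ≤ C * (n : ℝ) ^ t := by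
  intro h
  have hd1 : (1 : ℝ) < d := by exact_mod_cast (by omega : 1 < d)
  -- eventually `n ^ t / d ^ n < 1 / C`
  have hlim := (tendsto_pow_const_div_const_pow_of_one_lt t hd1).eventually_lt_const
    (inv_pos.2 hC)
  obtain ⟨n, hn, hn1⟩ := (hlim.and (eventually_ge_atTop 1)).exists
  rw [div_lt_iff₀ (by positivity), inv_mul_eq_div, lt_div_iff₀ hC] at hn
  linarith [h n hn1]

variable {F : Type u} [Field F] [CharZero F] {k : ℕ}

/-- Only the tuples with fewer than `t` entries in `S` contribute to the codimensions of `W`. -/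
theorem hasPolynomialGrowth_of_mem_identitiesOf (hk : 2 ≤ k)
    {W : Set (LAlgebra.{u, u, u} F (MatDer F k))} (hW : W ⊆ generatedVariety (matAlgebra F k))
    {f : UnitalLPoly F (MatDer F k)} (hf : f ∈ identitiesOf W)
    (hfA : f ∉ (matAlgebra F k).identities) : HasPolynomialGrowth W := by
  obtain ⟨t, ht, h⟩ := exists_prod_extCoeff_mem hk hf hfA
  have hmain := fun (n : ℕ) (hn : 1 ≤ n) => finite_and_codim_le hk hW hn
    (fun β => (Finset.univ.filter fun j => β j ≠ none).card < t)
    fun β hβ => h n β (not_lt.1 hβ)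
  set d := Fintype.card (Option (SIndex k)) with hd
  have hd0 : 0 < d := Fintype.card_pos
  refine ⟨fun n hn => (hmain n hn).1, (d : ℝ) ^ t * d, t, by positivity, ht, fun n hn => ?_⟩
  have h1 := (hmain n hn).2.trans (Nat.mul_le_mul_right _ (card_support_lt_le hn t))
  rw [Nat.card_eq_fintype_card, ← hd] at h1
  calc (codim W n : ℝ) ≤ ((n * d) ^ t * d : ℕ) := by exact_mod_cast h1
    _ = (d : ℝ) ^ t * d * (n : ℝ) ^ t := by
      push_cast
      ring

theorem isUMonomialIdentity_of_mem_identitiesOf (hk : 2 ≤ k)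
    {W : Set (LAlgebra.{u, u, u} F (MatDer F k))} (hW : W ⊆ generatedVariety (matAlgebra F k))
    {f : UnitalLPoly F (MatDer F k)} (hf : f ∈ identitiesOf W)
    (hfA : f ∉ (matAlgebra F k).identities) :
    ∃ t : ℕ, 1 ≤ t ∧ ∀ n : ℕ, t ≤ n → ∀ a b : Fin n → SIndex k,
      IsUMonomialIdentity (matAlgebra F k) W (fun i => phi F (a i) (b i)) := by
  obtain ⟨t, ht, h⟩ := exists_prod_extCoeff_mem hk hf hfA
  refine ⟨t, ht, fun n hn a b => ⟨fun i => smulRight_sCoeff_mem_range hk (a i) (b i), ?_⟩⟩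
  intro e he
  refine mem_identitiesOf_of_evalFun_mem hW
    (multilinearPoly_le_freeLAlgebra (ht.trans hn) (monomial_mem_multilinearPoly e)) ?_
  convert h n (fun j => some (a j)) (by simpa using hn)
    (List.ofFn fun j => sMatrix F (b j)).prod using 1
  funext γ
  rw [evalFun_apply, matEval_monomial, ← list_prod_ofFn_smul]
  refine congrArg (fun l => (List.ofFn l).prod) (funext fun j => ?_)
  exact DFunLike.congr_fun (he j) (γ j)

end Growth

end LDiff

theorem mainTheorem3 (F : Type u) [Field F] [CharZero F] (k : ℕ) (hk : 2 ≤ k) :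
    HasAlmostPolynomialGrowth (generatedVariety (matAlgebra F k)) ∧
    (∃ d : ℝ, 1 < d ∧ HasExponent (generatedVariety (matAlgebra F k)) d) ∧
    (∀ W : Set (LAlgebra.{u, u, u} F (MatDer F k)),
      IsVariety W → W ⊂ generatedVariety (matAlgebra F k) →
        ∃ t : ℕ, 1 ≤ t ∧ ∀ n : ℕ, t ≤ n → ∀ a b : Fin n → SIndex k,
          IsUMonomialIdentity (matAlgebra F k) W (fun i => phi F (a i) (b i))) := by
  set d := Fintype.card (Option (SIndex k)) with hd
  have hd2 : 2 ≤ d := by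
    rw [hd, card_option_sIndex hk]
    nlinarith
  have hup := fun (n : ℕ) (hn : 1 ≤ n) =>
    finite_and_codim_le (F := F) hk le_rfl hn (fun _ => True) (by simp)
  have hle : ∀ n, 1 ≤ n → codim (generatedVariety (matAlgebra F k)) n ≤ d ^ n * d := by
    intro n hn
    refine (hup n hn).2.trans_eq ?_
    rw [Nat.card_congr (Equiv.subtypeUnivEquiv fun _ => trivial), Nat.card_fun, Nat.card_fin,
      Nat.card_eq_fintype_card]
  have hge : ∀ n, 1 ≤ n → d ^ n ≤ codim (generatedVariety (matAlgebra F k)) n :=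
    fun n hn => pow_card_le_codim hk hn
  refine ⟨⟨fun n hn => (hup n hn).1, ?_, fun W hW hlt => ?_⟩,
    ⟨d, by exact_mod_cast hd2, tendsto_rpow_one_div_of_pow_le (by omega) hge hle⟩,
    fun W hW hlt => ?_⟩
  · rintro ⟨-, C, t, hC, -, h⟩
    refine not_forall_pow_le_mul_pow hd2 C hC t fun n hn => le_trans ?_ (h n hn)
    exact_mod_cast hge n hn
  · obtain ⟨f, hf, hfA⟩ := exists_mem_identitiesOf_of_ssubset hW hlt
    exact hasPolynomialGrowth_of_mem_identitiesOf hk hlt.subset hf hfA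
  · obtain ⟨f, hf, hfA⟩ := exists_mem_identitiesOf_of_ssubset hW hlt
    exact isUMonomialIdentity_of_mem_identitiesOf hk hlt.subset hf hfA
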